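/- Notation. Let $n\ge 1$, let $\mathbb D^n(0,\rho)=\{z\in\mathbb C^n:|z_l|<\rho,\ l=1,\dots,n\}$ and $\mathbb D^n=\mathbb D^n(0,1)$. For $\alpha\in\mathbb N^n$ put $|\alpha|=\alpha_1+\dots+\alpha_n$ and $z^\alpha=z_1^{\alpha_1}\cdots z_n^{\alpha_n}$. Let $\alpha(0)=0,\alpha(1),\alpha(2),\dots$ be the enumeration of $\mathbb N^n$ in graded lexicographic order: $\alpha(k_1)$ precedes $\alpha(k_2)$ if $|\alpha(k_1)|<|\alpha(k_2)|$, or if $|\alpha(k_1)|=|\alpha(k_2)|$ and $\alpha_j(k_1)>\alpha_j(k_2)$ for the smallest $j$ with $\alpha_j(k_1)\ne\alpha_j(k_2)$. Put $\widehat e_k(w)=w^{\alpha(k)}$. For a vector field $G$ holomorphic near $0$ put $L_Gf=G\cdot\nabla f$, and for $f,g$ holomorphic near $0$ with Taylor coefficients $f_\beta,g_\beta$ at $0$ put $\langle f,g\rangle=\sum_\beta f_\beta\overline{g_\beta}$ whenever this converges (the inner product of the Hardy space $\mathbb H^2(\mathbb D^n)$); thus $\langle L_G\widehat e_k,\widehat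 e_j\rangle$ is the coefficient of $w^{\alpha(j)}$ in $L_G\widehat e_k$. Theorem. Let $\{\dot z=F^{(i)}(z)\}_{i=1}^m$ be a switched system with $F^{(i)}:\mathbb D^n\to\mathbb C^n$ holomorphic, such that each $F^{(i)}$ generates a forward flow $\varphi_i^t:\mathbb D^n\to\mathbb D^n$, $t\ge0$. Assume that - for every $i$, $F^{(i)}(0)=0$, all eigenvalues of the Jacobian matrix $JF^{(i)}(0)$ have negative real part, and $0$ is globally asymptotically stable on $\mathbb D^n$ for $\varphi_i^t$ (that is, Lyapunov stable and attracting every point of $\mathbb D^n$); - the complex Lie algebra of matrices generated by $JF^{(1)}(0),\dots,JF^{(m)}(0)$ is solvable; - $\rho\in(0,1]$ is such that $\varphi_i^t(\mathbb D^n(0,\rho))\subseteq\mathbb D^n(0,\rho)$ for all $i$ and all $t\ge 0$. Then there is an invertible complex matrix $P$ with $\|P^{-1}\|_\infty=1$ (the operator norm induced by the maximum norm) such that all $P^{-1}JF^{(i)}(0)P$ are upper triangular. For every such $P$ the following holds. Put $\widehat F^{(i)}(w)=P^{-1}F^{(i)}(Pw)$. For $i=1,\dots,m$ let $(b^{(i)}_{jk})_{j,k\ge1}$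 be nonnegative real numbers such that $\sum_{k\ge1}b^{(i)}_{jk}\le1$ for all $j\geq 1$, and $b^{(i)}_{jk}b^{(i)}_{kj}>0$ for all $j,k\ge 1$ with $\langle L_{\widehat F^{(i)}}\widehat e_k,\widehat e_j\rangle\ne0$. For $1\le k<j$ define $$Q^{(i)}_{jk}=\frac{|\langle L_{\widehat F^{(i)}}\widehat e_k,\widehat e_j\rangle|^2}{4\,|\Re\langle L_{\widehat F^{(i)}}\widehat e_j,\widehat e_j\rangle|\,|\Re\langle L_{\widehat F^{(i)}}\widehat e_k,\widehat e_k\rangle|}\cdot\frac1{b^{(i)}_{jk}b^{(i)}_{kj}}$$ if $\langle L_{\widehat F^{(i)}}\widehat e_k,\widehat e_j\rangle\ne0$, and $Q^{(i)}_{jk}=0$ otherwise. Let $(\epsilon_j)_{j\ge1}$ be positive real numbers with $$\epsilon_j>\max_{1\le i\le m,\ 1\le k\le j-1}\epsilon_k\,Q^{(i)}_{jk}\qquad(j\ge2),$$ and suppose that $\sum_{k\ge1}|\alpha(k)|\,\epsilon_k\,\rho^{2|\alpha(k)|}$ converges. Then the switched system is globally uniformly asymptotically stable (GUAS) on $\mathbb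 D^n(0,\rho)$. Moreover, the series $$V(z)=\sum_{k=1}^\infty\epsilon_k\left|(P^{-1}z)^{\alpha(k)}\right|^2$$ converges for every $z\in\mathbb D^n(0,\rho)$, and $V$ is a common Lyapunov function on $\mathbb D^n(0,\rho)$: it is $C^1$ in the real sense, $V(0)=0$, and for all $z\in\mathbb D^n(0,\rho)\setminus\{0\}$ one has $V(z)>0$ and $\nabla V\cdot F^{(i)}(z)<0$ for every $i$. Here a commutation law is a piecewise constant function $\sigma:[0,\infty)\to\{1,\dots,m\}$ with finitely many discontinuities in every bounded interval; a trajectory for $\sigma$ is a continuous $x:[0,\infty)\to\mathbb D^n$ with $\dot x(t)=F^{(\sigma(t))}(x(t))$ at every time $t$ at which $\sigma$ is continuous. GUAS on $D$ means: for every $\epsilon>0$ there is $\delta>0$ such that $\|x(0)\|\le\delta$ implies $\|x(t)\|\le\epsilon$ for all $t>0$, for all $\sigma$ and all trajectories $x$ for $\sigma$; there is $\delta>0$ such that $\|x(0)\|\le\delta$ implies $x(t)\to0$ as $t\to\infty$, for all $\sigma$ and all trajectories $x$ for $\sigma$; and $x(0)\in D$ implies $x(t)\to0$ as $t\to\infty$,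 for all $\sigma$ and all trajectories $x$ for $\sigma$. -/

import Mathlib

open scoped Matrix Topology

namespace SwitchedKoopman

/-! ### Multi-indices and the graded lexicographic enumeration of monomials -/

/-- Total degree `|α| = α₁ + ⋯ + αₙ`. -/
def degree {n : ℕ} (α : Fin n → ℕ) : ℕ := ∑ l, α l

/-- The order on monomials: `z^α` precedes `z^β` if `|α| < |β|`, or if `|α| = |β|` and
`α_j > β_j` for the smallest `j` such that `α_j ≠ β_j`. -/
def MonomialLT {n : ℕ} (α β : Fin n → ℕ) : Prop :=
  degree α < degree β ∨
    (degree α = degree β ∧ ∃ j, β j < α j ∧ ∀ i < j, α i = β i)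

/-- A copy of the set of multi-indices, to carry the monomial order. -/
def GradedIndex (n : ℕ) : Type := Fin n → ℕ

/-- The key that turns the monomial order into a lexicographic order. -/
def monomialKey {n : ℕ} (α : Fin n → ℕ) : ℕ ×ₗ Lex (Fin n → ℕᵒᵈ) :=
  toLex (degree α, toLex fun i => OrderDual.toDual (α i))

theorem monomialKey_injective {n : ℕ} : Function.Injective (monomialKey (n := n)) := by
  intro α β h
  funext i
  exact congrFun (congrArg (fun p => ofLex (ofLex p).2) h) i

theorem monomialLT_of_key {n : ℕ} {α β : Fin n → ℕ} (h : monomialKey α < monomialKey β) :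
    MonomialLT α β := by
  rcases (Prod.Lex.toLex_lt_toLex.1 h) with h | ⟨h, j, hj, hlt⟩
  · exact Or.inl h
  · exact Or.inr ⟨h, j, hlt, fun i hi => hj i hi⟩

/-- There is an enumeration `α(0), α(1), …` of all multi-indices which is increasing for the
monomial order (and it is unique, as the order is total). -/
theorem exists_monomialEnum (n : ℕ) [NeZero n] :
    ∃ a : ℕ → (Fin n → ℕ), Function.Bijective a ∧ ∀ k j, k < j → MonomialLT (a k) (a j) := by
  classical
  let key : GradedIndex n → ℕ ×ₗ Lex (Fin n → ℕᵒᵈ) := fun α => monomialKey (n := n) α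
  have hkey : Function.Injective key := monomialKey_injective
  let _ : LinearOrder (GradedIndex n) := LinearOrder.lift' key hkey
  have hle : ∀ α β : GradedIndex n, α ≤ β ↔ key α ≤ key β := fun _ _ => Iff.rfl
  have hlt : ∀ α β : GradedIndex n, α < β ↔ key α < key β := fun _ _ => Iff.rfl
  have hdeg : ∀ α β : GradedIndex n, α ≤ β → degree (n := n) α ≤ degree (n := n) β := by
    intro α β h
    rcases (Prod.Lex.toLex_le_toLex.1 ((hle α β).1 h)) with h | ⟨h, -⟩
    · exact h.le
    · exact h.le
  have hfin : ∀ N : ℕ, {α : Fin n → ℕ | degree α ≤ N}.Finite := by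
    intro N
    refine (Set.Finite.pi' (ι := Fin n) (t := fun _ => {a : ℕ | a ≤ N})
      (fun _ => Set.finite_le_nat N)).subset ?_
    intro α hα i
    exact (Finset.single_le_sum (f := α) (fun _ _ => Nat.zero_le _) (Finset.mem_univ i)).trans hα
  let _ : LocallyFiniteOrder (GradedIndex n) := LocallyFiniteOrder.ofFiniteIcc fun α β =>
    (hfin (degree (n := n) β)).subset fun γ hγ => hdeg _ _ hγ.2
  let _ : OrderBot (GradedIndex n) :=
    { bot := fun _ => (0 : ℕ)
      bot_le := by
        intro α
        by_cases h : degree (n := n) α = 0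
        · have : α = fun _ => (0 : ℕ) := by
            funext i
            exact (Finset.sum_eq_zero_iff.1 h) i (Finset.mem_univ i)
          exact this.ge
        · refine le_of_lt ((hlt _ _).2 (Prod.Lex.toLex_lt_toLex.2 (Or.inl ?_)))
          simpa [degree] using Nat.pos_of_ne_zero h }
  have _ : NoMaxOrder (GradedIndex n) := ⟨fun α => by
    refine ⟨fun i => (α i + 1 : ℕ), (hlt _ _).2 (Prod.Lex.toLex_lt_toLex.2 (Or.inl ?_))⟩
    exact Finset.sum_lt_sum_of_nonempty (s := (Finset.univ : Finset (Fin n)))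
      ⟨0, Finset.mem_univ _⟩ fun i _ => Nat.lt_succ_self (α i)⟩
  let _ : SuccOrder (GradedIndex n) := LinearLocallyFiniteOrder.succOrder _
  let _ : PredOrder (GradedIndex n) := LinearLocallyFiniteOrder.predOrder _
  let e : GradedIndex n ≃o ℕ := orderIsoNatOfLinearSuccPredArch
  exact ⟨e.symm, e.symm.bijective, fun k j h =>
    monomialLT_of_key ((hlt _ _).1 (e.symm.lt_iff_lt.2 h))⟩

/-- The map `k ↦ α(k)`; thus `α(0) = 0` and `α(1), …, α(n)` are the unit multi-indices. -/
noncomputable def monomialEnum (n : ℕ) [NeZero n] : ℕ → (Fin n → ℕ) :=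
  Classical.choose (exists_monomialEnum n)

theorem monomialEnum_bijective (n : ℕ) [NeZero n] : Function.Bijective (monomialEnum n) :=
  (Classical.choose_spec (exists_monomialEnum n)).1

theorem monomialEnum_lt (n : ℕ) [NeZero n] {k j : ℕ} (h : k < j) :
    MonomialLT (monomialEnum n k) (monomialEnum n j) :=
  (Classical.choose_spec (exists_monomialEnum n)).2 k j h

/-- The monomial `z^α`. -/
def monomial {n : ℕ} (α : Fin n → ℕ) (z : Fin n → ℂ) : ℂ := ∏ l, z l ^ α l

/-! ### The polydisk, Taylor coefficients and the Koopman matrix -/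

/-- The open polydisk `𝔻ⁿ(0, ρ)`. -/
def polydisk (n : ℕ) (ρ : ℝ) : Set (Fin n → ℂ) := {z | ∀ l, ‖z l‖ < ρ}

/-- The complex partial derivative `∂f/∂z_l`. -/
noncomputable def partialDeriv {n : ℕ} (l : Fin n) (f : (Fin n → ℂ) → ℂ) : (Fin n → ℂ) → ℂ :=
  fun z => fderiv ℂ f z (Pi.single l 1)

/-- The mixed derivative `∂₁^{β₁} ⋯ ∂ₙ^{βₙ} f`. -/
noncomputable def mixedDeriv {n : ℕ} (β : Fin n → ℕ) (f : (Fin n → ℂ) → ℂ) : (Fin n → ℂ) → ℂ :=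
  (List.finRange n).foldr (fun l g => (partialDeriv l)^[β l] g) f

/-- The coefficient of `z^β` in the Taylor series at `0` of a function holomorphic near `0`. -/
noncomputable def taylorCoeff {n : ℕ} (f : (Fin n → ℂ) → ℂ) (β : Fin n → ℕ) : ℂ :=
  mixedDeriv β f 0 / ((∏ l, (β l).factorial : ℕ) : ℂ)

/-- The inner product `⟨f, g⟩ = ∑_β f_β conj(g_β)` of the Hardy space `H²(𝔻ⁿ)`, for which the
monomials are orthonormal, written in Taylor coefficients at `0`. -/
noncomputable def hardyInner {n : ℕ} (f g : (Fin n → ℂ) → ℂ) : ℂ :=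
  ∑' β : Fin n → ℕ, taylorCoeff f β * (starRingEnd ℂ) (taylorCoeff g β)

/-- The Koopman generator `L_F f = F · ∇f`. -/
noncomputable def koopmanGenerator {n : ℕ} (F : (Fin n → ℂ) → (Fin n → ℂ))
    (f : (Fin n → ℂ) → ℂ) : (Fin n → ℂ) → ℂ :=
  fun z => fderiv ℂ f z (F z)

/-- The entry `⟨L_F e_k, e_j⟩` of the Koopman matrix, with `e_k(z) = z^{α(k)}`. -/
noncomputable def koopmanEntry {n : ℕ} [NeZero n] (F : (Fin n → ℂ) → (Fin n → ℂ)) (k j : ℕ) : ℂ :=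
  hardyInner (koopmanGenerator F (monomial (monomialEnum n k))) (monomial (monomialEnum n j))

/-- The Jacobian matrix `JF(z)`. -/
noncomputable def jacobian {n : ℕ} (F : (Fin n → ℂ) → (Fin n → ℂ)) (z : Fin n → ℂ) :
    Matrix (Fin n) (Fin n) ℂ :=
  LinearMap.toMatrix' (fderiv ℂ F z : (Fin n → ℂ) →ₗ[ℂ] (Fin n → ℂ))

section

attribute [local instance] LieRing.ofAssociativeRing

/-- The complex Lie algebra of matrices generated by the `A⁽ⁱ⁾`, with bracket `[A, B] = AB - BA`, is
solvable. -/
def GeneratesSolvable {n m : ℕ} (A : Fin m → Matrix (Fin n) (Fin n) ℂ) : Prop :=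
  LieAlgebra.IsSolvable (LieSubalgebra.lieSpan ℂ (Matrix (Fin n) (Fin n) ℂ) (Set.range A))

end

open scoped Matrix.Norms.Operator in
/-- The matrix norm `‖A‖_∞` induced by the maximum norm (the maximal absolute row sum). -/
noncomputable def infNorm {n : ℕ} (A : Matrix (Fin n) (Fin n) ℂ) : ℝ := ‖A‖

/-- `P` is invertible, `‖P⁻¹‖_∞ = 1`, and every `P⁻¹ A⁽ⁱ⁾ P` is upper triangular. -/
def IsNormalizedTriangularizer {n m : ℕ} (A : Fin m → Matrix (Fin n) (Fin n) ℂ)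
    (P : Matrix (Fin n) (Fin n) ℂ) : Prop :=
  IsUnit P ∧ infNorm P⁻¹ = 1 ∧ ∀ i, (P⁻¹ * A i * P).BlockTriangular id

/-- The vector field in the coordinates `w = P⁻¹ z`, that is `w ↦ P⁻¹ F(P w)`. -/
noncomputable def conjField {n : ℕ} (P : Matrix (Fin n) (Fin n) ℂ)
    (F : (Fin n → ℂ) → (Fin n → ℂ)) : (Fin n → ℂ) → (Fin n → ℂ) :=
  fun w => P⁻¹ *ᵥ F (P *ᵥ w)

open scoped Classical in
/-- The number `Q_{jk}` built from the Koopman matrix of `F` and the weights `b`. -/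
noncomputable def crossRatio {n : ℕ} [NeZero n] (F : (Fin n → ℂ) → (Fin n → ℂ))
    (b : ℕ → ℕ → ℝ) (j k : ℕ) : ℝ :=
  if koopmanEntry F k j ≠ 0 then
    ‖koopmanEntry F k j‖ ^ 2 / (4 * |(koopmanEntry F j j).re| * |(koopmanEntry F k k).re|)
      * (1 / (b j k * b k j))
  else 0

/-! ### Flows, stability and Lyapunov functions -/

/-- `φ` is the forward flow of `ż = F(z)` on the state space `X`, which it maps into itself. -/
structure IsForwardFlow {n : ℕ} (X : Set (Fin n → ℂ)) (F : (Fin n → ℂ) → (Fin n → ℂ))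
    (φ : ℝ → (Fin n → ℂ) → (Fin n → ℂ)) : Prop where
  zero : ∀ z ∈ X, φ 0 z = z
  mapsTo : ∀ t, 0 ≤ t → Set.MapsTo (φ t) X X
  deriv : ∀ z ∈ X, ∀ t, 0 ≤ t →
    HasDerivWithinAt (fun s => φ s z) (F (φ t z)) (Set.Ici 0) t

/-- The equilibrium `0` is globally asymptotically stable on `X` for the flow `φ`. -/
def IsGASFlow {n : ℕ} (X : Set (Fin n → ℂ)) (φ : ℝ → (Fin n → ℂ) → (Fin n → ℂ)) : Prop :=
  (∀ ε > 0, ∃ δ > 0, ∀ z ∈ X, ‖z‖ ≤ δ → ∀ t, 0 ≤ t → ‖φ t z‖ ≤ ε) ∧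
    ∀ z ∈ X, Filter.Tendsto (fun t => φ t z) Filter.atTop (𝓝 0)

/-- A commutation law on `[0, ∞)`: a function with values in the discrete set `{1, …, m}` that has
finitely many discontinuities in every bounded interval (hence is piecewise constant). -/
def IsCommutationLaw {m : ℕ} (σ : ℝ → Fin m) : Prop :=
  ∀ T : ℝ, {t | 0 ≤ t ∧ t ≤ T ∧ ¬ ContinuousWithinAt σ (Set.Ici 0) t}.Finite

/-- `x` is a trajectory in `X` of the switched system: a continuous curve on `[0, ∞)` which solves
`ẋ(t) = F^{(σ(t))}(x(t))` at all times where `σ` does not switch. -/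
structure IsSwitchedTrajectory {n m : ℕ} (X : Set (Fin n → ℂ))
    (F : Fin m → (Fin n → ℂ) → (Fin n → ℂ)) (σ : ℝ → Fin m) (x : ℝ → (Fin n → ℂ)) : Prop where
  continuousOn : ContinuousOn x (Set.Ici 0)
  mem : ∀ t, 0 ≤ t → x t ∈ X
  deriv : ∀ t, 0 ≤ t → ContinuousWithinAt σ (Set.Ici 0) t →
    HasDerivWithinAt x (F (σ t) (x t)) (Set.Ici 0) t

/-- The equilibrium `0` of the switched system on `X` is uniformly asymptotically stable. -/
def IsUAS {n m : ℕ} (X : Set (Fin n → ℂ)) (F : Fin m → (Fin n → ℂ) → (Fin n → ℂ)) : Prop :=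
  (∀ ε > 0, ∃ δ > 0, ∀ σ : ℝ → Fin m, IsCommutationLaw σ → ∀ x, IsSwitchedTrajectory X F σ x →
    ‖x 0‖ ≤ δ → ∀ t, 0 < t → ‖x t‖ ≤ ε) ∧
  (∃ δ > 0, ∀ σ : ℝ → Fin m, IsCommutationLaw σ → ∀ x, IsSwitchedTrajectory X F σ x →
    ‖x 0‖ ≤ δ → Filter.Tendsto x Filter.atTop (𝓝 0))

/-- The equilibrium `0` of the switched system on `X` is globally uniformly asymptotically stable
on `D ⊆ X`. -/
def IsGUAS {n m : ℕ} (X : Set (Fin n → ℂ)) (F : Fin m → (Fin n → ℂ) → (Fin n → ℂ))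
    (D : Set (Fin n → ℂ)) : Prop :=
  IsUAS X F ∧
    ∀ σ : ℝ → Fin m, IsCommutationLaw σ → ∀ x, IsSwitchedTrajectory X F σ x →
      x 0 ∈ D → Filter.Tendsto x Filter.atTop (𝓝 0)

/-- `V` is a common Lyapunov function on the open set `D` for the family `F` and the equilibrium
`0`; `C¹` and the derivative are meant in the real sense (`ℂⁿ = ℝ²ⁿ`). -/
structure IsCommonLyapunov {n m : ℕ} (F : Fin m → (Fin n → ℂ) → (Fin n → ℂ))
    (D : Set (Fin n → ℂ)) (V : (Fin n → ℂ) → ℝ) : Prop where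
  contDiffOn : ContDiffOn ℝ 1 V D
  zero : V 0 = 0
  pos : ∀ z ∈ D, z ≠ 0 → 0 < V z
  deriv_neg : ∀ i, ∀ z ∈ D, z ≠ 0 → fderiv ℝ V z (F i z) < 0

end SwitchedKoopman

open SwitchedKoopman

/-! In the coordinates `w = P⁻¹ z` every Jacobian at `0` is upper triangular. The terms of lowest
degree in `L_F w^α` have exponents `α - e_l + e_q` with coefficients `α_l J_{lq}`, nonzero only for
`l ≤ q`. Moving a unit from `l` to a later `q` moves the exponent later in the graded lexicographic
order. Hence the Koopman matrix `A k j = ⟨L e_k, e_j⟩` vanishes for `j < k`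
(`koopmanEntry_eq_zero`), and its diagonal entries `∑ α_l J_{ll}` have negative real part, the
`J_{ll}` being eigenvalues.

With `v_k = w^{α(k)}`, the derivative of `V` along `F` is `2 Re ∑_{k,j} ε_k conj(v_k) A_{kj} v_j`.
Put `D_j = 2 |Re A_{jj}| ε_j |v_j|²`. The diagonal contributes `-∑ D_j`. By the arithmetic-geometric
mean inequality, the condition on `ε` bounds the entry `(k, j)`, `k < j`, by `b_{jk} D_j + b_{kj}
D_k` (`two_mul_le_of_crossRatio_lt`). As the rows of `b` sum to at most `1`, these bounds add up to
at most `∑ D_j - ∑ b_{jj} D_j`. Since `b_{jj} > 0`, the total is strictly negative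
(`IsDominated.tsum_neg`).

Analysis is needed to identify this double series with the derivative of `V`. The hypothesis on `∑
|α(k)| ε_k ρ^{2|α(k)|}` permits termwise differentiation. The domain of the field in the coordinate
`w` is convex but need not be a polydisk, so convergence of the Taylor series of `L_F e_k` at `w` is
not automatic. The domination itself makes the double series absolutely convergent, and an
absolutely convergent Taylor series at a point of a convex domain has the right sum
(`hasSum_taylorCoeff`).

A Lyapunov function on a polydisk does not by itself confine trajectories to that polydisk.
Confinement comes from the Schwarz lemma: a flow map is holomorphic along complex lines through `0`,
fixes `0` and preserves the polydisk, hence does not increase the maximum norm there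
(`IsForwardFlow.norm_le`). Therefore the norm decreases weakly along every switched trajectory that
starts in the polydisk. This gives stability, and with the strict decrease of `V` on compact shells
it gives convergence to `0`. -/

namespace SwitchedKoopman

/-! ### Cauchy estimates and holomorphy of directional derivatives. -/

section Regularity

open Metric Filter

variable {E G : Type*} [NormedAddCommGroup E] [NormedSpace ℂ E]
  [NormedAddCommGroup G] [NormedSpace ℂ G]

/-- Cauchy estimate for the derivative on a smaller ball. -/
theorem norm_fderiv_le_of_forall_norm_le {f : E → G} {c : E} {R M : ℝ} (hR : 0 < R)
    (hd : DifferentiableOn ℂ f (ball c R)) (hM : ∀ z ∈ ball c R, ‖f z‖ ≤ M) :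
    ‖fderiv ℂ f c‖ ≤ 2 * M / R := by
  refine Complex.norm_fderiv_le_div_of_mapsTo_ball hd (fun z hz => ?_) hR
  rw [mem_closedBall, dist_eq_norm]
  have h1 := hM z hz
  have h2 := hM c (mem_ball_self hR)
  linarith [norm_sub_le (f z) (f c)]

/-- The derivative of a holomorphic map is locally Lipschitz. -/
theorem exists_lipschitz_fderiv {f : E → G} {U : Set E} (hU : IsOpen U)
    (hf : DifferentiableOn ℂ f U) {c : E} (hc : c ∈ U) :
    ∃ R > 0, ∃ L ≥ 0, ball c R ⊆ U ∧
      ∀ x ∈ ball c R, ∀ y ∈ ball c R, ‖fderiv ℂ f y - fderiv ℂ f x‖ ≤ L * ‖y - x‖ := by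
  have hcont : ContinuousAt f c := (hf c hc).continuousWithinAt.continuousAt (hU.mem_nhds hc)
  have hb : ∀ᶠ z in 𝓝 c, ‖f z‖ ≤ ‖f c‖ + 1 :=
    (hcont.norm.eventually (eventually_le_nhds (lt_add_one _)))
  obtain ⟨R0, hR0, hball⟩ := Metric.eventually_nhds_iff_ball.1 (hb.and (hU.mem_nhds hc))
  set M := ‖f c‖ + 1 with hM
  have hMpos : 0 < M := by positivity
  -- Two margins are needed: balls of radius `R` about points of `ball c (3 * R)` must stay in `ball
  -- c R0`, and for `x`, `y` in `ball c R` both `ball x R` and its translate by `y - x` must stay in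
  -- `ball c (3 * R)`.
  set R := R0 / 4 with hRdef
  have hR : 0 < R := by positivity
  have hdiff : ∀ z ∈ ball c R0, DifferentiableAt ℂ f z := fun z hz =>
    (hf z (hball z hz).2).differentiableAt (hU.mem_nhds (hball z hz).2)
  have hK : ∀ z ∈ ball c (3 * R), ‖fderiv ℂ f z‖ ≤ 2 * M / R := by
    intro z hz
    have hsub : ball z R ⊆ ball c R0 := by
      refine ball_subset_ball' ?_
      rw [mem_ball] at hz
      linarith
    exact norm_fderiv_le_of_forall_norm_le hR
      (fun w hw => (hdiff w (hsub hw)).differentiableWithinAt) fun w hw => (hball w (hsub hw)).1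
  refine ⟨R, hR, 2 * (2 * M / R) / R, by positivity,
    fun z hz => (hball z (ball_subset_ball (by linarith) hz)).2, fun x hx y hy => ?_⟩
  set h := y - x with hh
  have hmem : ∀ z ∈ ball x R, z ∈ ball c (3 * R) ∧ z + h ∈ ball c (3 * R) := by
    intro z hz
    simp only [mem_ball, dist_eq_norm] at hz hx hy ⊢
    constructor
    · calc ‖z - c‖ = ‖(z - x) + (x - c)‖ := by congr 1; abel
        _ ≤ _ := norm_add_le _ _
        _ < 3 * R := by linarith
    · calc ‖z + h - c‖ = ‖(z - x) + (y - c)‖ := by congr 1; rw [hh]; abel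
        _ ≤ _ := norm_add_le _ _
        _ < 3 * R := by linarith
  have hlt : 3 * R < R0 := by linarith
  have hd1 : ∀ z ∈ ball x R, DifferentiableAt ℂ (fun z => f (z + h)) z := fun z hz =>
    DifferentiableAt.comp z (g := f) (f := fun z => z + h)
      (hdiff _ (ball_subset_ball hlt.le (hmem z hz).2)) (by fun_prop)
  have hd2 : ∀ z ∈ ball x R, DifferentiableAt ℂ f z := fun z hz =>
    hdiff _ (ball_subset_ball hlt.le (hmem z hz).1)
  -- The mean value inequality bounds the increment `f (z + h) - f z` by a multiple of `‖h‖`.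
  -- Cauchy's estimate for this function of `z` then bounds the difference of the two derivatives.
  have key := norm_fderiv_le_of_forall_norm_le (f := fun z => f (z + h) - f z) (c := x) hR
    (M := 2 * M / R * ‖h‖)
    (fun z hz => ((hd1 z hz).sub (hd2 z hz)).differentiableWithinAt) (fun z hz => by
      have := (convex_ball c (3 * R)).norm_image_sub_le_of_norm_fderiv_le (𝕜 := ℂ) (f := f)
        (fun w hw => hdiff w (ball_subset_ball hlt.le hw)) hK (hmem z hz).1 (hmem z hz).2
      simpa using this)
  have hx0 : x ∈ ball x R := mem_ball_self hR
  have e1 : fderiv ℂ (fun z => f (z + h) - f z) x = fderiv ℂ f y - fderiv ℂ f x := by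
    have : fderiv ℂ (fun z => f (z + h)) x = fderiv ℂ f y := by
      rw [fderiv_comp_add_right]
      congr 1
      rw [hh]; abel
    rw [fderiv_fun_sub (hd1 x hx0) (hd2 x hx0), this]
  rw [e1] at key
  calc _ ≤ _ := key
    _ = _ := by ring

theorem continuousOn_fderiv_of_differentiableOn {f : E → G} {U : Set E} (hU : IsOpen U)
    (hf : DifferentiableOn ℂ f U) : ContinuousOn (fderiv ℂ f) U := by
  intro c hc
  obtain ⟨R, hR, L, hL, -, hlip⟩ := exists_lipschitz_fderiv hU hf hc
  refine ContinuousAt.continuousWithinAt ?_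
  have : LipschitzOnWith (L.toNNReal) (fderiv ℂ f) (ball c R) :=
    LipschitzOnWith.of_dist_le_mul fun x hx y hy => by
      rw [dist_eq_norm, dist_eq_norm, Real.coe_toNNReal _ hL]
      exact hlip y hy x hx
  exact this.continuousOn.continuousAt (ball_mem_nhds _ hR)

/-- A uniform limit of holomorphic maps is holomorphic. -/
theorem differentiableAt_of_tendstoUniformlyOn [CompleteSpace G] {ι : Type*} {l : Filter ι}
    [NeBot l] {f : ι → E → G} {g : E → G} {c : E} {R : ℝ} (hR : 0 < R)
    (hf : ∀ᶠ i in l, DifferentiableOn ℂ (f i) (ball c R))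
    (hlim : TendstoUniformlyOn f g l (ball c R)) : DifferentiableAt ℂ g c := by
  have hsub : ∀ z ∈ ball c (R / 2), ball z (R / 2) ⊆ ball c R := fun z hz => by
    refine ball_subset_ball' ?_
    rw [mem_ball] at hz
    linarith
  have hdiff : ∀ᶠ i in l, ∀ z ∈ ball c R, DifferentiableAt ℂ (f i) z := hf.mono fun i hi z hz =>
    (hi z hz).differentiableAt (isOpen_ball.mem_nhds hz)
  -- Cauchy's estimate, applied to differences on balls of radius `R / 2`, passes the uniform Cauchy
  -- property from the maps to their derivatives.
  have hcauchy : UniformCauchySeqOn (fun i => fderiv ℂ (f i)) l (ball c (R / 2)) := by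
    intro u hu
    obtain ⟨η, hη, hu⟩ := Metric.mem_uniformity_dist.1 hu
    have h1 := Metric.tendstoUniformlyOn_iff.1 hlim (η * R / 16) (by positivity)
    have h2 := h1.and hdiff
    filter_upwards [h2.prod_mk h2] with p hp z hz
    refine hu ?_
    have hd : ∀ w ∈ ball z (R / 2), DifferentiableAt ℂ (fun w => f p.1 w - f p.2 w) w :=
      fun w hw => (hp.1.2 w (hsub z hz hw)).sub (hp.2.2 w (hsub z hz hw))
    have hzR : z ∈ ball c R := hsub z hz (mem_ball_self (by positivity))
    have key := norm_fderiv_le_of_forall_norm_le (f := fun w => f p.1 w - f p.2 w) (c := z)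
      (R := R / 2) (M := η * R / 8) (by positivity)
      (fun w hw => (hd w hw).differentiableWithinAt) (fun w hw => by
        have a1 := hp.1.1 w (hsub z hz hw)
        have a2 := hp.2.1 w (hsub z hz hw)
        rw [← dist_eq_norm]
        linarith [dist_triangle_left (f p.1 w) (f p.2 w) (g w)])
    rw [fderiv_fun_sub (hp.1.2 z hzR) (hp.2.2 z hzR), ← dist_eq_norm] at key
    calc _ ≤ _ := key
      _ = η / 2 := by field_simp; norm_num
      _ < η := by linarith
  have hlim' : ∀ z ∈ ball c (R / 2),
      ∃ A, Tendsto (fun i => fderiv ℂ (f i) z) l (𝓝 A) := fun z hz =>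
    cauchy_map_iff_exists_tendsto.1 (hcauchy.cauchy_map hz)
  choose! A hA using hlim'
  have hunif := hcauchy.tendstoUniformlyOn_of_tendsto hA
  have hc : c ∈ ball c (R / 2) := mem_ball_self (by positivity)
  refine (hasFDerivAt_of_tendstoUniformlyOnFilter (l := l) (f := f) (g := g) (g' := A)
    (f' := fun i => fderiv ℂ (f i)) (x := c) ?_ ?_ ?_).differentiableAt
  · exact hunif.tendstoUniformlyOnFilter.mono_right (by
      rw [le_principal_iff]; exact ball_mem_nhds _ (by positivity))
  · have : ∀ᶠ y in 𝓝 c, y ∈ ball c R := ball_mem_nhds _ hR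
    filter_upwards [hdiff.prod_mk this] with p hp
    exact (hp.1 _ hp.2).hasFDerivAt
  · filter_upwards [ball_mem_nhds c hR] with y hy
    exact hlim.tendsto_at hy

/-- Directional derivatives of a holomorphic map are holomorphic. -/
theorem differentiableOn_fderiv_apply [CompleteSpace G] {f : E → G} {U : Set E} (hU : IsOpen U)
    (hf : DifferentiableOn ℂ f U) (v : E) : DifferentiableOn ℂ (fun z => fderiv ℂ f z v) U := by
  intro c hc
  refine DifferentiableAt.differentiableWithinAt ?_
  obtain ⟨R, hR, L, hL, hsub, hlip⟩ := exists_lipschitz_fderiv hU hf hc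
  have hd : ∀ z ∈ ball c R, DifferentiableAt ℂ f z := fun z hz =>
    (hf z (hsub hz)).differentiableAt (hU.mem_nhds (hsub hz))
  have hmem : ∀ h : ℂ, ‖h‖ * (‖v‖ + 1) < R / 2 → ∀ z ∈ ball c (R / 2), z + h • v ∈ ball c R := by
    intro h hh z hz
    rw [mem_ball, dist_eq_norm] at hz ⊢
    calc ‖z + h • v - c‖ = ‖(z - c) + h • v‖ := by congr 1; abel
      _ ≤ ‖z - c‖ + ‖h‖ * ‖v‖ := (norm_add_le _ _).trans (by rw [norm_smul])
      _ < R := by nlinarith [norm_nonneg h, norm_nonneg v]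
  have hball : ball c (R / 2) ⊆ ball c R := ball_subset_ball (by linarith)
  have hsmall : ∀ η > 0, ∀ᶠ h : ℂ in 𝓝[≠] 0, ‖h‖ * (‖v‖ + 1) < η := by
    intro η hη
    have : Tendsto (fun h : ℂ => ‖h‖ * (‖v‖ + 1)) (𝓝 0) (𝓝 0) := by
      have : Continuous fun h : ℂ => ‖h‖ * (‖v‖ + 1) := by fun_prop
      simpa using this.tendsto 0
    exact (this.eventually (gt_mem_nhds hη)).filter_mono nhdsWithin_le_nhds
  -- The directional derivative is a limit of difference quotients, which are holomorphic in `z`;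
  -- the Lipschitz bound on the derivative makes the convergence uniform.
  refine differentiableAt_of_tendstoUniformlyOn (l := 𝓝[≠] (0 : ℂ)) (R := R / 2)
    (f := fun h z => h⁻¹ • (f (z + h • v) - f z)) (by positivity) ?_ ?_
  · filter_upwards [hsmall (R / 2) (by positivity)] with h hh z hz
    refine DifferentiableAt.differentiableWithinAt ?_
    refine DifferentiableAt.const_smul (DifferentiableAt.sub ?_ (hd z (hball hz))) _
    exact DifferentiableAt.comp z (g := f) (f := fun z => z + h • v) (hd _ (hmem h hh z hz))
      (by fun_prop)
  · rw [Metric.tendstoUniformlyOn_iff]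
    intro η hη
    filter_upwards [hsmall (R / 2) (by positivity), hsmall (η / (L * (‖v‖ + 1) + 1)) (by positivity),
      self_mem_nhdsWithin] with h hh hh2 hne z hz
    have hne : h ≠ 0 := hne
    have hseg : segment ℝ z (z + h • v) ⊆ ball c R :=
      (convex_ball c R).segment_subset (hball hz) (hmem h hh z hz)
    have key := (convex_segment (𝕜 := ℝ) z (z + h • v)).norm_image_sub_le_of_norm_fderiv_le'
      (𝕜 := ℂ) (f := f) (φ := fderiv ℂ f z) (C := L * (‖h‖ * ‖v‖)) (x := z) (y := z + h • v)
      (fun w hw => hd w (hseg hw)) (fun w hw => by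
        refine (hlip z (hball hz) w (hseg hw)).trans ?_
        refine mul_le_mul_of_nonneg_left ?_ hL
        have := norm_sub_le_of_mem_segment hw
        simpa [norm_smul] using this)
      (left_mem_segment ℝ _ _) (right_mem_segment ℝ _ _)
    simp only [add_sub_cancel_left, map_smul, norm_smul] at key
    rw [dist_comm, dist_eq_norm]
    have e : h⁻¹ • (f (z + h • v) - f z) - fderiv ℂ f z v
        = h⁻¹ • (f (z + h • v) - f z - h • fderiv ℂ f z v) := by
      rw [smul_sub, smul_sub, smul_smul, inv_mul_cancel₀ hne, one_smul, smul_sub]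
    have hpos : 0 < ‖h‖ := norm_pos_iff.2 hne
    rw [e, norm_smul, norm_inv]
    calc ‖h‖⁻¹ * ‖f (z + h • v) - f z - h • fderiv ℂ f z v‖
        ≤ ‖h‖⁻¹ * (L * (‖h‖ * ‖v‖) * (‖h‖ * ‖v‖)) := by gcongr
      _ = L * ‖v‖ * (‖h‖ * ‖v‖) := by field_simp
      _ ≤ (L * (‖v‖ + 1) + 1) * (‖h‖ * (‖v‖ + 1)) := by gcongr <;> linarith
      _ < (L * (‖v‖ + 1) + 1) * (η / (L * (‖v‖ + 1) + 1)) := by gcongr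
      _ = η := by field_simp

end Regularity

/-! ### Taylor expansion along complex lines through the origin. -/

section Taylor

open Metric Filter Finset

variable {n : ℕ}

/-- Functions on `ℂⁿ` that are holomorphic on `U` and vanish outside `U`. -/
def holomorphicOn (U : Set (Fin n → ℂ)) : Submodule ℂ ((Fin n → ℂ) → ℂ) where
  carrier := {g | DifferentiableOn ℂ g U ∧ ∀ z ∉ U, g z = 0}
  add_mem' ha hb := ⟨ha.1.add hb.1, fun z hz => by simp [ha.2 z hz, hb.2 z hz]⟩
  zero_mem' := ⟨differentiableOn_const 0, fun _ _ => rfl⟩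
  smul_mem' c _ ha := ⟨ha.1.const_smul c, fun z hz => by simp [ha.2 z hz]⟩

theorem partialDeriv_congr {U : Set (Fin n → ℂ)} (hU : IsOpen U) {f g : (Fin n → ℂ) → ℂ}
    (h : Set.EqOn f g U) (l : Fin n) : Set.EqOn (partialDeriv l f) (partialDeriv l g) U := by
  intro z hz
  have : f =ᶠ[𝓝 z] g := h.eventuallyEq_of_mem (hU.mem_nhds hz)
  simp only [partialDeriv, this.fderiv_eq]

theorem differentiableOn_partialDeriv {U : Set (Fin n → ℂ)} (hU : IsOpen U)
    {f : (Fin n → ℂ) → ℂ} (hf : DifferentiableOn ℂ f U) (l : Fin n) :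
    DifferentiableOn ℂ (partialDeriv l f) U :=
  differentiableOn_fderiv_apply hU hf _

theorem fderiv_apply_eq_sum {G : Type*} [NormedAddCommGroup G] [NormedSpace ℂ G]
    (A : (Fin n → ℂ) →L[ℂ] G) (w : Fin n → ℂ) :
    A w = ∑ l, w l • A (Pi.single l 1) := by
  conv_lhs => rw [pi_eq_sum_univ' w]
  rw [map_sum]
  refine Finset.sum_congr rfl fun l _ => ?_
  rw [map_smul]

theorem partialDeriv_comm {U : Set (Fin n → ℂ)} (hU : IsOpen U)
    {f : (Fin n → ℂ) → ℂ} (hf : DifferentiableOn ℂ f U) (l m : Fin n) :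
    Set.EqOn (partialDeriv l (partialDeriv m f)) (partialDeriv m (partialDeriv l f)) U := by
  intro z hz
  have hnhds := hU.mem_nhds hz
  -- The full derivative is a finite combination of directional derivatives, each already known to
  -- be holomorphic.
  have hdd : DifferentiableAt ℂ (fderiv ℂ f) z := by
    have e : fderiv ℂ f = fun y => ∑ l, (ContinuousLinearMap.proj (R := ℂ) (φ := fun _ => ℂ) l).smulRight
        (fderiv ℂ f y (Pi.single l 1)) := by
      funext y
      ext w
      rw [fderiv_apply_eq_sum]
      simp
    rw [e]
    refine DifferentiableAt.fun_sum fun i _ => ?_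
    have := (differentiableOn_fderiv_apply hU hf (Pi.single i 1)).differentiableAt hnhds
    exact ((ContinuousLinearMap.smulRightL ℂ (Fin n → ℂ) ℂ
      (ContinuousLinearMap.proj (R := ℂ) (φ := fun _ => ℂ) i)).differentiableAt).comp z this
  have hev : ∀ᶠ y in 𝓝 z, HasFDerivAt f (fderiv ℂ f y) y := by
    filter_upwards [hnhds, hU.eventually_mem hz] with y _ hy
    exact (hf.differentiableAt (hU.mem_nhds hy)).hasFDerivAt
  have hsymm := second_derivative_symmetric_of_eventually hev hdd.hasFDerivAt
  have e2 : ∀ i j : Fin n, partialDeriv i (partialDeriv j f) z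
      = fderiv ℂ (fderiv ℂ f) z (Pi.single i 1) (Pi.single j 1) := by
    intro i j
    have := (hdd.hasFDerivAt.clm_apply (hasFDerivAt_const (Pi.single j (1 : ℂ) : Fin n → ℂ) z)).fderiv
    change fderiv ℂ (fun y => fderiv ℂ f y (Pi.single j 1)) z (Pi.single i 1) = _
    rw [this]
    simp
  rw [e2, e2, hsymm]

open scoped Classical in
/-- The partial derivative as an operator on functions holomorphic on `U`. -/
noncomputable def partialOp {U : Set (Fin n → ℂ)} (hU : IsOpen U) (l : Fin n) :
    Module.End ℂ (holomorphicOn U) where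
  toFun g := ⟨U.indicator (partialDeriv l g.1),
    (differentiableOn_partialDeriv hU g.2.1 l).congr fun z hz => Set.indicator_of_mem hz _,
    fun z hz => Set.indicator_of_notMem hz _⟩
  map_add' f g := by
    ext z
    by_cases hz : z ∈ U
    · have h1 := f.2.1.differentiableAt (hU.mem_nhds hz)
      have h2 := g.2.1.differentiableAt (hU.mem_nhds hz)
      simp [hz, partialDeriv, fderiv_add h1 h2]
    · simp [hz]
  map_smul' c g := by
    ext z
    by_cases hz : z ∈ U
    · have h1 := g.2.1.differentiableAt (hU.mem_nhds hz)
      simp [hz, partialDeriv, fderiv_const_smul h1]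
    · simp [hz]

theorem partialOp_eqOn {U : Set (Fin n → ℂ)} (hU : IsOpen U) (l : Fin n) (g : holomorphicOn U) :
    Set.EqOn (partialOp hU l g).1 (partialDeriv l g.1) U :=
  fun _ hz => Set.indicator_of_mem hz _

theorem holomorphicOn_ext {U : Set (Fin n → ℂ)} {f g : holomorphicOn U}
    (h : Set.EqOn f.1 g.1 U) : f = g := by
  ext z
  by_cases hz : z ∈ U
  · exact h hz
  · rw [f.2.2 z hz, g.2.2 z hz]

/-- Elements of `holomorphicOn U` vanish off `U`, so equality on `U` is equality and symmetry of
second derivatives becomes an identity of operators. It permits the multinomial theorem for powers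
of `∑ w_l ∂_l`. -/
theorem partialOp_commute {U : Set (Fin n → ℂ)} (hU : IsOpen U) (l m : Fin n) :
    Commute (partialOp hU l) (partialOp hU m) := by
  refine LinearMap.ext fun g => holomorphicOn_ext fun z hz => ?_
  simp only [Module.End.mul_apply]
  rw [partialOp_eqOn hU l _ hz, partialOp_eqOn hU m _ hz,
    partialDeriv_congr hU (partialOp_eqOn hU m g) l hz,
    partialDeriv_congr hU (partialOp_eqOn hU l g) m hz, partialDeriv_comm hU g.2.1 l m hz]

theorem partialOp_pow_eqOn {U : Set (Fin n → ℂ)} (hU : IsOpen U) (l : Fin n) (k : ℕ)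
    (g : holomorphicOn U) {f : (Fin n → ℂ) → ℂ} (h : Set.EqOn g.1 f U) :
    Set.EqOn ((partialOp hU l ^ k) g).1 ((partialDeriv l)^[k] f) U := by
  induction k with
  | zero => simpa using h
  | succ k ih =>
    rw [pow_succ', Function.iterate_succ_apply', Module.End.mul_apply]
    exact (partialOp_eqOn hU l _).trans (partialDeriv_congr hU ih l)

theorem noncommProd_partialOp_eqOn {U : Set (Fin n → ℂ)} (hU : IsOpen U) (β : Fin n → ℕ)
    (g : holomorphicOn U) (hc : ((univ : Finset (Fin n)) : Set (Fin n)).Pairwise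
      (Function.onFun Commute fun l => partialOp hU l ^ β l)) :
    Set.EqOn ((univ : Finset (Fin n)).noncommProd (fun l => partialOp hU l ^ β l) hc g).1
      (mixedDeriv β g.1) U := by
  have e : (univ : Finset (Fin n)).noncommProd (fun l => partialOp hU l ^ β l) hc
      = ((List.finRange n).map fun l => partialOp hU l ^ β l).prod := by
    have : (univ : Finset (Fin n)) = (List.finRange n).toFinset := by ext; simp
    rw [Finset.noncommProd_congr this (fun _ _ => rfl)]
    exact Finset.noncommProd_toFinset _ _ _ (List.nodup_finRange n)
  rw [e]
  unfold mixedDeriv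
  induction List.finRange n with
  | nil => exact fun z _ => rfl
  | cons l L ih =>
    rw [List.map_cons, List.prod_cons, List.foldr_cons, Module.End.mul_apply]
    exact partialOp_pow_eqOn hU l _ _ ih

theorem hasDerivAt_slice {U : Set (Fin n → ℂ)} (hU : IsOpen U) (g : holomorphicOn U)
    (w : Fin n → ℂ) {ζ : ℂ} (hζ : ζ • w ∈ U) :
    HasDerivAt (fun ζ : ℂ => g.1 (ζ • w)) (((∑ l, w l • partialOp hU l) g).1 (ζ • w)) ζ := by
  have h1 := (g.2.1.differentiableAt (hU.mem_nhds hζ)).hasFDerivAt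
  have h2 : HasDerivAt (fun ζ : ℂ => ζ • w) w ζ := by
    simpa using (hasDerivAt_id ζ).smul_const w
  have := h1.comp_hasDerivAt ζ h2
  refine this.congr_deriv ?_
  rw [fderiv_apply_eq_sum]
  symm
  simp only [LinearMap.sum_apply, LinearMap.smul_apply, Submodule.coe_sum, Submodule.coe_smul,
    Finset.sum_apply, Pi.smul_apply]
  exact Finset.sum_congr rfl fun l _ => by rw [partialOp_eqOn hU l g hζ]; rfl

theorem iteratedDeriv_slice {U : Set (Fin n → ℂ)} (hU : IsOpen U) (g : holomorphicOn U)
    (w : Fin n → ℂ) (d : ℕ) {ζ : ℂ} (hζ : ζ • w ∈ U) :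
    iteratedDeriv d (fun ζ : ℂ => g.1 (ζ • w)) ζ
      = (((∑ l, w l • partialOp hU l) ^ d) g).1 (ζ • w) := by
  induction d generalizing ζ with
  | zero => simp
  | succ d ih =>
    have hV : IsOpen {ζ : ℂ | ζ • w ∈ U} := hU.preimage (by fun_prop)
    rw [iteratedDeriv_succ, pow_succ', Module.End.mul_apply]
    have : iteratedDeriv d (fun ζ : ℂ => g.1 (ζ • w)) =ᶠ[𝓝 ζ]
        fun ζ => (((∑ l, w l • partialOp hU l) ^ d) g).1 (ζ • w) := by
      filter_upwards [hV.mem_nhds hζ] with y hy using ih hy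
    rw [this.deriv_eq]
    exact (hasDerivAt_slice hU _ w hζ).deriv

theorem noncommProd_smul_pow {R A ι : Type*} [CommSemiring R] [Semiring A] [Algebra R A]
    (s : Finset ι) (c : ι → R) (x : ι → A) (β : ι → ℕ)
    (hx : (s : Set ι).Pairwise (Function.onFun Commute fun i => x i ^ β i))
    (hcx : (s : Set ι).Pairwise (Function.onFun Commute fun i => (c i • x i) ^ β i)) :
    s.noncommProd (fun i => (c i • x i) ^ β i) hcx
      = (∏ i ∈ s, c i ^ β i) • s.noncommProd (fun i => x i ^ β i) hx := by
  classical
  induction s using Finset.induction_on with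
  | empty => simp
  | insert a s ha ih =>
    rw [Finset.noncommProd_insert_of_notMem _ _ _ _ ha, Finset.noncommProd_insert_of_notMem _ _ _ _ ha,
      Finset.prod_insert ha, ih (hx.mono (by simp)), smul_pow, smul_mul_smul_comm]

/-- The homogeneous part of degree `d` of the Taylor series at `0`. -/
noncomputable def taylorHomogeneous (f : (Fin n → ℂ) → ℂ) (d : ℕ) (w : Fin n → ℂ) : ℂ :=
  ∑ β ∈ piAntidiag univ d, taylorCoeff f β * monomial β w

/-- On the line through `w`, differentiation in `ζ` is the operator `∑ w_l ∂_l`. Its power expands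
by the multinomial theorem, whose coefficients times `∏ β_l!` equal `d!`. -/
theorem iteratedDeriv_slice_zero {U : Set (Fin n → ℂ)} (hU : IsOpen U) (h0 : 0 ∈ U)
    (g : holomorphicOn U) (w : Fin n → ℂ) (d : ℕ) :
    iteratedDeriv d (fun ζ : ℂ => g.1 (ζ • w)) 0 = d.factorial * taylorHomogeneous g.1 d w := by
  rw [iteratedDeriv_slice hU g w d (by simpa using h0)]
  have hc : ((univ : Finset (Fin n)) : Set (Fin n)).Pairwise
      (Function.onFun Commute fun l => w l • partialOp hU l) := fun l _ m _ _ =>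
    ((partialOp_commute hU l m).smul_left _).smul_right _
  rw [Finset.sum_pow_eq_sum_piAntidiag_of_commute _ _ hc, zero_smul, taylorHomogeneous,
    Finset.mul_sum, LinearMap.sum_apply, Submodule.coe_sum, Finset.sum_apply]
  refine Finset.sum_congr rfl fun β hβ => ?_
  have hsum : ∑ l, β l = d := (mem_piAntidiag.1 hβ).1
  have hcβ : ((univ : Finset (Fin n)) : Set (Fin n)).Pairwise
      (Function.onFun Commute fun l => partialOp hU l ^ β l) := fun l _ m _ _ =>
    (partialOp_commute hU l m).pow_pow _ _
  rw [noncommProd_smul_pow _ _ _ _ hcβ]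
  have hmult : ((∏ l, (β l).factorial : ℕ) : ℂ) * (Nat.multinomial univ β : ℂ) = d.factorial := by
    rw [← hsum]; exact_mod_cast Nat.multinomial_spec univ β
  have hne : ((∏ l, (β l).factorial : ℕ) : ℂ) ≠ 0 := by
    exact_mod_cast (Finset.prod_pos fun l _ => Nat.factorial_pos (β l)).ne'
  have hnat : ∀ (k : ℕ) (T : Module.End ℂ (holomorphicOn U)),
      ((((k : Module.End ℂ (holomorphicOn U)) * T) g).1 : (Fin n → ℂ) → ℂ) 0 = k * (T g).1 0 := by
    intro k T
    rw [← nsmul_eq_mul]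
    simp
  rw [hnat, LinearMap.smul_apply, Submodule.coe_smul, Pi.smul_apply,
    noncommProd_partialOp_eqOn hU β g hcβ h0, taylorCoeff, ← hmult, monomial, smul_eq_mul]
  field_simp

theorem mixedDeriv_congr {U : Set (Fin n → ℂ)} (hU : IsOpen U) {f g : (Fin n → ℂ) → ℂ}
    (h : Set.EqOn f g U) (β : Fin n → ℕ) : Set.EqOn (mixedDeriv β f) (mixedDeriv β g) U := by
  unfold mixedDeriv
  induction List.finRange n with
  | nil => exact h
  | cons l L ih =>
    simp only [List.foldr_cons]
    generalize β l = k
    induction k with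
    | zero => exact ih
    | succ k ih2 =>
      simp only [Function.iterate_succ_apply']
      exact partialDeriv_congr hU ih2 l

theorem taylorHomogeneous_congr {U : Set (Fin n → ℂ)} (hU : IsOpen U) (h0 : 0 ∈ U)
    {f g : (Fin n → ℂ) → ℂ} (h : Set.EqOn f g U) (d : ℕ) (w : Fin n → ℂ) :
    taylorHomogeneous f d w = taylorHomogeneous g d w := by
  simp only [taylorHomogeneous, taylorCoeff, mixedDeriv_congr hU h _ h0]

/-- Taylor expansion of a holomorphic function along complex lines through `0`. -/
theorem eventually_hasSum_taylorHomogeneous {U : Set (Fin n → ℂ)} (hU : IsOpen U) (h0 : 0 ∈ U)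
    {f : (Fin n → ℂ) → ℂ} (hf : DifferentiableOn ℂ f U) (w : Fin n → ℂ) :
    ∀ᶠ ζ : ℂ in 𝓝 0, HasSum (fun d => taylorHomogeneous f d w * ζ ^ d) (f (ζ • w)) := by
  classical
  let g : holomorphicOn U := ⟨U.indicator f, hf.congr fun z hz => Set.indicator_of_mem hz _,
    fun z hz => Set.indicator_of_notMem hz _⟩
  have hg : Set.EqOn g.1 f U := fun z hz => Set.indicator_of_mem hz _
  have hV : IsOpen {ζ : ℂ | ζ • w ∈ U} := hU.preimage (by fun_prop)
  obtain ⟨r, hr, hball⟩ := Metric.isOpen_iff.1 hV 0 (by simpa using h0)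
  filter_upwards [ball_mem_nhds (0 : ℂ) hr] with ζ hζ
  have hd : DifferentiableOn ℂ (fun ζ : ℂ => g.1 (ζ • w)) (ball 0 r) := fun ζ hζ =>
    (hasDerivAt_slice hU g w (hball hζ)).differentiableAt.differentiableWithinAt
  have := Complex.hasSum_taylorSeries_on_ball hd hζ
  rw [← hg (hball hζ)]
  refine (funext fun d => ?_ : (fun d => taylorHomogeneous f d w * ζ ^ d) = _) ▸ this
  rw [iteratedDeriv_slice_zero hU h0 g w d, taylorHomogeneous_congr hU h0 hg]
  have := Nat.cast_ne_zero (R := ℂ).2 (Nat.factorial_ne_zero d)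
  simp only [sub_zero, smul_eq_mul]
  field_simp

end Taylor

/-! ### The Koopman matrix: lowest order terms, triangularity, diagonal. -/

section Coefficients

open Metric Filter Finset

variable {n : ℕ}

/-- The coefficients of a power series are determined by its sum near `0`. -/
theorem coeff_eq_of_eventually_hasSum {a b : ℕ → ℂ} {f : ℂ → ℂ}
    (ha : ∀ᶠ ζ : ℂ in 𝓝 0, HasSum (fun d => a d * ζ ^ d) (f ζ))
    (hb : ∀ᶠ ζ : ℂ in 𝓝 0, HasSum (fun d => b d * ζ ^ d) (f ζ)) : a = b := by
  have key : ∀ c : ℕ → ℂ, (∀ᶠ ζ : ℂ in 𝓝 0, HasSum (fun d => c d * ζ ^ d) (f ζ)) →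
      HasFPowerSeriesAt f (FormalMultilinearSeries.ofScalars ℂ c) 0 := by
    intro c hc
    rw [hasFPowerSeriesAt_iff]
    filter_upwards [hc] with ζ hζ
    have e : (fun d => ζ ^ d • (FormalMultilinearSeries.ofScalars ℂ c).coeff d)
        = fun d => c d * ζ ^ d := by
      funext d
      simp [FormalMultilinearSeries.coeff_ofScalars, mul_comm]
    rw [zero_add, e]
    exact hζ
  have := (key a ha).eq_formalMultilinearSeries (key b hb)
  funext d
  have h := congrArg (fun p => FormalMultilinearSeries.coeff p d) this
  simpa [FormalMultilinearSeries.coeff_ofScalars] using h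

theorem mem_piAntidiag_univ {β : Fin n → ℕ} {d : ℕ} :
    β ∈ piAntidiag univ d ↔ degree β = d := by
  simp [degree]

/-- Two polynomials with the same values over the infinite field `ℂ` have the same coefficients. -/
theorem coeff_eq_of_forall_sum_eq {d : ℕ} {c c' : (Fin n → ℕ) → ℂ}
    (h : ∀ w, ∑ β ∈ piAntidiag univ d, c β * monomial β w
      = ∑ β ∈ piAntidiag univ d, c' β * monomial β w) {β : Fin n → ℕ} (hβ : degree β = d) :
    c β = c' β := by
  let p : ((Fin n → ℕ) → ℂ) → MvPolynomial (Fin n) ℂ := fun c =>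
    ∑ β ∈ piAntidiag univ d, MvPolynomial.monomial (Finsupp.equivFunOnFinite.symm β) (c β)
  have heval : ∀ c w, MvPolynomial.eval w (p c)
      = ∑ β ∈ piAntidiag univ d, c β * monomial β w := by
    intro c w
    simp only [p, map_sum, MvPolynomial.eval_monomial, monomial]
    refine Finset.sum_congr rfl fun β _ => ?_
    rw [Finsupp.prod_fintype _ _ (fun i => by simp)]
    simp
  have hcoeff : ∀ c, MvPolynomial.coeff (Finsupp.equivFunOnFinite.symm β) (p c) = c β := by
    intro c
    simp only [p, MvPolynomial.coeff_sum, MvPolynomial.coeff_monomial]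
    rw [Finset.sum_eq_single β]
    · simp
    · intro γ _ hγ
      rw [if_neg]
      exact fun h => hγ (Finsupp.equivFunOnFinite.symm.injective h)
    · intro hn
      exact absurd (mem_piAntidiag_univ.2 hβ) hn
  have : p c = p c' := MvPolynomial.funext fun w => by rw [heval, heval, h w]
  rw [← hcoeff c, this, hcoeff]

theorem monomial_smul (β : Fin n → ℕ) (ζ : ℂ) (w : Fin n → ℂ) :
    monomial β (ζ • w) = monomial β w * ζ ^ degree β := by
  simp only [monomial, Pi.smul_apply, smul_eq_mul, mul_pow, Finset.prod_mul_distrib, degree]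
  rw [Finset.prod_pow_eq_pow_sum, mul_comm]

/-- Natural subtraction leaves `α - Pi.single l 1` equal to `α` when `α l = 0`; the factor `α l`
then removes the term. -/
theorem hasFDerivAt_monomial (α : Fin n → ℕ) (w : Fin n → ℂ) :
    HasFDerivAt (monomial α) (∑ l, ((α l : ℂ) * monomial (α - Pi.single l 1) w) •
      ContinuousLinearMap.proj (R := ℂ) (φ := fun _ => ℂ) l) w := by
  have h : ∀ l ∈ (univ : Finset (Fin n)), HasFDerivAt (fun z : Fin n → ℂ => z l ^ α l)
      (((α l : ℂ) * w l ^ (α l - 1)) • ContinuousLinearMap.proj (R := ℂ) (φ := fun _ => ℂ) l) w := by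
    intro l _
    have := (hasFDerivAt_apply (𝕜 := ℂ) l w).pow (α l)
    refine this.congr_fderiv ?_
    ext i
    simp
  have := HasFDerivAt.finsetProd h
  refine this.congr_fderiv (Finset.sum_congr rfl fun l _ => ?_)
  rw [smul_smul]
  congr 1
  rw [monomial, ← Finset.mul_prod_erase univ _ (Finset.mem_univ l)]
  have : ∀ i ∈ univ.erase l, w i ^ (α - Pi.single l 1 : Fin n → ℕ) i = w i ^ α i := by
    intro i hi
    have : i ≠ l := (Finset.mem_erase.1 hi).1
    simp [this]
  rw [Finset.prod_congr rfl this]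
  simp
  ring

theorem differentiable_monomial (α : Fin n → ℕ) : Differentiable ℂ (monomial α) :=
  fun w => (hasFDerivAt_monomial α w).differentiableAt

theorem koopmanGenerator_monomial (F : (Fin n → ℂ) → (Fin n → ℂ)) (α : Fin n → ℕ)
    (w : Fin n → ℂ) : koopmanGenerator F (monomial α) w
      = ∑ l, (α l : ℂ) * monomial (α - Pi.single l 1) w * F w l := by
  simp [koopmanGenerator, (hasFDerivAt_monomial α w).fderiv]

/-- By homogeneity the restriction to each line is a single power of `ζ`. Uniqueness of coefficients
is used in `ζ`, and then in `w`. -/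
theorem taylorCoeff_monomial (α β : Fin n → ℕ) :
    taylorCoeff (monomial α) β = if β = α then 1 else 0 := by
  classical
  have h := fun w => coeff_eq_of_eventually_hasSum
    (eventually_hasSum_taylorHomogeneous isOpen_univ (Set.mem_univ 0)
      (differentiable_monomial α).differentiableOn w)
    (b := fun d => if d = degree α then monomial α w else 0) (Eventually.of_forall fun ζ => by
      rw [monomial_smul]
      have := hasSum_ite_eq (degree α) (monomial α w * ζ ^ degree α)
      refine (funext fun d => ?_ : (fun d => (if d = degree α then monomial α w else 0) * ζ ^ d)
        = _) ▸ this
      split_ifs with h <;> simp [h])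
  refine coeff_eq_of_forall_sum_eq (c := taylorCoeff (monomial α))
    (c' := fun β => if β = α then 1 else 0) (d := degree β) (fun w => ?_) rfl
  have := congrFun (h w) (degree β)
  rw [taylorHomogeneous] at this
  rw [this]
  simp only [ite_mul, one_mul, zero_mul, Finset.sum_ite_eq', mem_piAntidiag_univ]
  simp [eq_comm]

theorem hardyInner_monomial (f : (Fin n → ℂ) → ℂ) (α : Fin n → ℕ) :
    hardyInner f (monomial α) = taylorCoeff f α := by
  rw [hardyInner, tsum_eq_single α]
  · simp [taylorCoeff_monomial]
  · intro β hβ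
    simp [taylorCoeff_monomial, hβ]

theorem koopmanEntry_eq_taylorCoeff [NeZero n] (F : (Fin n → ℂ) → (Fin n → ℂ)) (k j : ℕ) :
    koopmanEntry F k j
      = taylorCoeff (koopmanGenerator F (monomial (monomialEnum n k))) (monomialEnum n j) :=
  hardyInner_monomial _ _

theorem degree_sub_single {α : Fin n → ℕ} {l : Fin n} (hl : α l ≠ 0) :
    degree (α - Pi.single l 1) = degree α - 1 := by
  have h : α = (α - Pi.single l 1) + Pi.single l 1 := by
    funext i
    by_cases hi : i = l
    · subst hi; simp; omega
    · simp [hi]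
  have h2 : degree α = degree (α - Pi.single l 1) + 1 := by
    conv_lhs => rw [h]
    simp [degree, Finset.sum_add_distrib]
  omega

theorem differentiableOn_koopmanGenerator {U : Set (Fin n → ℂ)}
    {F : (Fin n → ℂ) → (Fin n → ℂ)} (hF : DifferentiableOn ℂ F U) (α : Fin n → ℕ) :
    DifferentiableOn ℂ (koopmanGenerator F (monomial α)) U := by
  have : koopmanGenerator F (monomial α)
      = fun w => ∑ l, (α l : ℂ) * monomial (α - Pi.single l 1) w * F w l :=
    funext fun w => koopmanGenerator_monomial F α w
  rw [this]
  refine DifferentiableOn.fun_sum fun l _ => DifferentiableOn.mul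
    ((differentiable_monomial _).differentiableOn.const_mul _) ?_
  exact differentiableOn_pi.1 hF l

theorem jacobian_apply (F : (Fin n → ℂ) → (Fin n → ℂ)) (z : Fin n → ℂ) (l q : Fin n) :
    jacobian F z l q = fderiv ℂ F z (Pi.single q 1) l := by
  simp [jacobian, LinearMap.toMatrix'_apply]

/-- The lowest order terms of the Taylor expansion of `L_F w^α`. -/
theorem taylorHomogeneous_koopmanGenerator {U : Set (Fin n → ℂ)} (hU : IsOpen U) (h0 : 0 ∈ U)
    {F : (Fin n → ℂ) → (Fin n → ℂ)} (hF : DifferentiableOn ℂ F U) (hF0 : F 0 = 0)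
    (α : Fin n → ℕ) (hα : degree α ≠ 0) (w : Fin n → ℂ) {d : ℕ} (hd : d ≤ degree α) :
    taylorHomogeneous (koopmanGenerator F (monomial α)) d w = if d = degree α then
      ∑ l, (α l : ℂ) * monomial (α - Pi.single l 1) w * ∑ q, w q * jacobian F 0 l q else 0 := by
  set N := degree α with hN
  let p : ℂ → ℂ := fun ζ => ∑ l, (α l : ℂ) * monomial (α - Pi.single l 1) w * F (ζ • w) l
  have hV : IsOpen {ζ : ℂ | ζ • w ∈ U} := hU.preimage (by fun_prop)
  obtain ⟨r, hr, hball⟩ := Metric.isOpen_iff.1 hV 0 (by simpa using h0)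
  have hFl : ∀ (l : Fin n) (ζ : ℂ), ζ ∈ ball (0 : ℂ) r →
      HasDerivAt (fun ζ : ℂ => F (ζ • w) l) (fderiv ℂ F (ζ • w) w l) ζ := by
    intro l ζ hζ
    have h1 := (hF.differentiableAt (hU.mem_nhds (hball hζ))).hasFDerivAt
    have h2 : HasDerivAt (fun ζ : ℂ => ζ • w) w ζ := by
      simpa using (hasDerivAt_id ζ).smul_const w
    exact hasDerivAt_pi.1 (h1.comp_hasDerivAt ζ h2) l
  have hp : ∀ ζ ∈ ball (0 : ℂ) r, HasDerivAt p
      (∑ l, (α l : ℂ) * monomial (α - Pi.single l 1) w * fderiv ℂ F (ζ • w) w l) ζ := by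
    intro ζ hζ
    exact HasDerivAt.fun_sum fun l _ => (hFl l ζ hζ).const_mul _
  have hpd : DifferentiableOn ℂ p (ball 0 r) := fun ζ hζ =>
    (hp ζ hζ).differentiableAt.differentiableWithinAt
  let a : ℕ → ℂ := fun d => ((d.factorial : ℂ))⁻¹ * iteratedDeriv d p 0
  -- Factoring out `ζ ^ (N - 1)` reduces the terms of degree at most `N` to `p 0 = 0` and `deriv p
  -- 0`, the latter being given by the Jacobian.
  have hgen : ∀ ζ : ℂ, koopmanGenerator F (monomial α) (ζ • w) = ζ ^ (N - 1) * p ζ := by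
    intro ζ
    rw [koopmanGenerator_monomial, Finset.mul_sum]
    refine Finset.sum_congr rfl fun l _ => ?_
    by_cases hl : α l = 0
    · simp [hl]
    · rw [monomial_smul, degree_sub_single hl]
      ring
  have huniq := coeff_eq_of_eventually_hasSum
    (eventually_hasSum_taylorHomogeneous hU h0 (differentiableOn_koopmanGenerator hF α) w)
    (b := fun d => if d < N - 1 then 0 else a (d - (N - 1))) (by
      filter_upwards [ball_mem_nhds (0 : ℂ) hr] with ζ hζ
      have hs := (Complex.hasSum_taylorSeries_on_ball hpd hζ).mul_left (ζ ^ (N - 1))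
      rw [hgen]
      rw [← hasSum_nat_add_iff' (N - 1)]
      rw [Finset.sum_eq_zero (fun i hi => by simp [Finset.mem_range.1 hi]), sub_zero]
      refine (funext fun d => ?_ : (fun d => (if d + (N - 1) < N - 1 then 0 else
        a (d + (N - 1) - (N - 1))) * ζ ^ (d + (N - 1))) = _) ▸ hs
      rw [if_neg (by omega), Nat.add_sub_cancel]
      simp only [a, sub_zero, smul_eq_mul]
      ring)
  rw [show taylorHomogeneous (koopmanGenerator F (monomial α)) d w = _ from congrFun huniq d]
  have ha0 : a 0 = 0 := by simp [a, p, hF0]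
  rcases lt_trichotomy d (N - 1) with h | h | h
  · simp only [if_pos h]
    rw [if_neg (by omega)]
  · subst h
    simp only [lt_irrefl, if_false, Nat.sub_self, ha0]
    rw [if_neg (by omega)]
  · have hdN : d = N := by omega
    subst hdN
    have hN1 : N - (N - 1) = 1 := by omega
    simp only [if_true, if_neg (not_lt.2 h.le), hN1]
    have h1 : a 1 = deriv p 0 := by simp [a]
    rw [h1, (hp 0 (mem_ball_self hr)).deriv]
    refine Finset.sum_congr rfl fun l _ => ?_
    rw [zero_smul, fderiv_apply_eq_sum, Finset.sum_apply]
    simp [jacobian_apply]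

theorem monomial_mul_apply (α : Fin n → ℕ) (w : Fin n → ℂ) (q : Fin n) :
    monomial α w * w q = monomial (α + Pi.single q 1) w := by
  simp only [monomial, Pi.add_apply, pow_add, Finset.prod_mul_distrib]
  congr 1
  rw [Finset.prod_eq_single q] <;> simp +contextual

theorem degree_sub_single_add_single {α : Fin n → ℕ} {l q : Fin n} (hl : α l ≠ 0) :
    degree (α - Pi.single l 1 + Pi.single q 1) = degree α := by
  have h1 := degree_sub_single hl
  have h2 : α l ≤ degree α := Finset.single_le_sum (fun _ _ => Nat.zero_le _) (Finset.mem_univ l)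
  have h3 : degree (α - Pi.single l 1 + Pi.single q 1) = degree (α - Pi.single l 1) + 1 := by
    simp only [degree, Pi.add_apply, Finset.sum_add_distrib]
    simp
  omega

/-- The degree condition is asked only where `c i ≠ 0`, because the exponents `α - e_l + e_q` have
the wrong degree when `α_l = 0`. -/
theorem sum_piAntidiag_sum_ite {ι : Type*} [Fintype ι] (c : ι → ℂ) (γ : ι → Fin n → ℕ) {N : ℕ}
    (h : ∀ i, c i ≠ 0 → degree (γ i) = N) (d : ℕ) (w : Fin n → ℂ) :
    ∑ β ∈ piAntidiag univ d, (∑ i, if β = γ i then c i else 0) * monomial β w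
      = if d = N then ∑ i, c i * monomial (γ i) w else 0 := by
  simp only [Finset.sum_mul]
  rw [Finset.sum_comm]
  have hi : ∀ i, ∑ β ∈ piAntidiag univ d, (if β = γ i then c i else 0) * monomial β w
      = if d = N then c i * monomial (γ i) w else 0 := by
    intro i
    simp only [ite_mul, zero_mul, Finset.sum_ite_eq', mem_piAntidiag_univ]
    by_cases hc : c i = 0
    · simp [hc]
    · rw [h i hc]
      simp only [eq_comm]
  rw [Finset.sum_congr rfl fun i _ => hi i]
  split_ifs <;> simp

theorem taylorCoeff_koopmanGenerator {U : Set (Fin n → ℂ)} (hU : IsOpen U) (h0 : 0 ∈ U)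
    {F : (Fin n → ℂ) → (Fin n → ℂ)} (hF : DifferentiableOn ℂ F U) (hF0 : F 0 = 0)
    (α : Fin n → ℕ) (hα : degree α ≠ 0) {β : Fin n → ℕ} (hβ : degree β ≤ degree α) :
    taylorCoeff (koopmanGenerator F (monomial α)) β = ∑ i : Fin n × Fin n,
      if β = α - Pi.single i.1 1 + Pi.single i.2 1 then
        (α i.1 : ℂ) * jacobian F 0 i.1 i.2 else 0 := by
  refine coeff_eq_of_forall_sum_eq (c := taylorCoeff (koopmanGenerator F (monomial α)))
    (c' := fun β => ∑ i : Fin n × Fin n,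
      if β = α - Pi.single i.1 1 + Pi.single i.2 1 then
        (α i.1 : ℂ) * jacobian F 0 i.1 i.2 else 0) (d := degree β) (fun w => ?_) rfl
  rw [sum_piAntidiag_sum_ite _ _ (N := degree α) (fun i hi =>
    degree_sub_single_add_single (by simpa using left_ne_zero_of_mul hi))]
  refine (taylorHomogeneous_koopmanGenerator hU h0 hF hF0 α hα w hβ).trans ?_
  split_ifs
  · rw [Fintype.sum_prod_type]
    refine Finset.sum_congr rfl fun l _ => ?_
    rw [Finset.mul_sum]
    refine Finset.sum_congr rfl fun q _ => ?_
    rw [← monomial_mul_apply]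
    ring
  · rfl

theorem MonomialLT.asymm {α β : Fin n → ℕ} (h : MonomialLT α β) : ¬ MonomialLT β α := by
  rintro (h' | ⟨h', j', hj', hlt'⟩)
  · rcases h with h | ⟨h, -⟩ <;> omega
  · rcases h with h | ⟨-, j, hj, hlt⟩
    · omega
    · rcases lt_trichotomy j j' with hh | hh | hh
      · have := hlt' j hh; omega
      · subst hh; omega
      · have := hlt j' hh; omega

variable [NeZero n]

theorem monomialEnum_zero : monomialEnum n 0 = 0 := by
  obtain ⟨k, hk⟩ := (monomialEnum_bijective n).2 0
  rcases Nat.eq_zero_or_pos k with h | h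
  · rw [← hk, h]
  · have h1 := monomialEnum_lt n h
    rw [hk] at h1
    rcases h1 with h1 | ⟨h1, j, hj, -⟩
    · simp [degree] at h1
    · have h2 : monomialEnum n 0 j ≤ degree (monomialEnum n 0) :=
        Finset.single_le_sum (fun _ _ => Nat.zero_le _) (Finset.mem_univ j)
      have h3 : degree (0 : Fin n → ℕ) = 0 := by simp [degree]
      have h4 : (0 : Fin n → ℕ) j = 0 := rfl
      omega

theorem degree_monomialEnum_ne_zero {k : ℕ} (hk : 1 ≤ k) : degree (monomialEnum n k) ≠ 0 := by
  intro h
  have : monomialEnum n k = monomialEnum n 0 := by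
    rw [monomialEnum_zero]
    funext i
    exact (Finset.sum_eq_zero_iff.1 h) i (Finset.mem_univ i)
  have := (monomialEnum_bijective n).1 this
  omega

theorem degree_monomialEnum_mono {j k : ℕ} (h : j ≤ k) :
    degree (monomialEnum n j) ≤ degree (monomialEnum n k) := by
  rcases h.eq_or_lt with h | h
  · rw [h]
  · rcases monomialEnum_lt n h with h | h
    · exact h.le
    · exact h.1.le

/-- The Koopman matrix is triangular if the Jacobian matrix is. -/
theorem koopmanEntry_eq_zero {U : Set (Fin n → ℂ)} (hU : IsOpen U) (h0 : 0 ∈ U)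
    {F : (Fin n → ℂ) → (Fin n → ℂ)} (hF : DifferentiableOn ℂ F U) (hF0 : F 0 = 0)
    (hJ : (jacobian F 0).BlockTriangular id) {j k : ℕ} (hjk : j < k) :
    koopmanEntry F k j = 0 := by
  rw [koopmanEntry_eq_taylorCoeff, taylorCoeff_koopmanGenerator hU h0 hF hF0 _
    (degree_monomialEnum_ne_zero (by omega)) (degree_monomialEnum_mono hjk.le)]
  refine Finset.sum_eq_zero fun ⟨l, q⟩ _ => ?_
  split_ifs with h
  · by_cases hl : monomialEnum n k l = 0
    · simp [hl]
    dsimp only at h ⊢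
    rcases lt_trichotomy l q with hlq | hlq | hlq
    -- For `l < q` the exponent at `l` drops and those before `l` are unchanged, so `α(j)` would
    -- come after `α(k)`, against `j < k`.
    · exfalso
      refine (monomialEnum_lt n hjk).asymm (Or.inr ⟨?_, l, ?_, fun i hi => ?_⟩)
      · rw [h, degree_sub_single_add_single hl]
      · rw [h]
        simp [hlq.ne]
        omega
      · rw [h]
        simp [hi.ne, (hi.trans hlq).ne]
    · exfalso
      subst hlq
      have : monomialEnum n j = monomialEnum n k := by
        rw [h]
        funext i
        by_cases hi : i = l
        · subst hi; simp; omega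
        · simp [hi]
      have := (monomialEnum_bijective n).1 this
      omega
    · rw [hJ hlq, mul_zero]
  · rfl

theorem koopmanEntry_diag {U : Set (Fin n → ℂ)} (hU : IsOpen U) (h0 : 0 ∈ U)
    {F : (Fin n → ℂ) → (Fin n → ℂ)} (hF : DifferentiableOn ℂ F U) (hF0 : F 0 = 0)
    {k : ℕ} (hk : 1 ≤ k) :
    koopmanEntry F k k = ∑ l, (monomialEnum n k l : ℂ) * jacobian F 0 l l := by
  rw [koopmanEntry_eq_taylorCoeff, taylorCoeff_koopmanGenerator hU h0 hF hF0 _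
    (degree_monomialEnum_ne_zero hk) le_rfl]
  rw [Fintype.sum_prod_type]
  refine Finset.sum_congr rfl fun l _ => ?_
  by_cases hl : monomialEnum n k l = 0
  · simp [hl]
  rw [Finset.sum_eq_single l]
  · rw [if_pos]
    funext i
    by_cases hi : i = l
    · subst hi; simp; omega
    · simp [hi]
  · intro q _ hq
    rw [if_neg]
    intro h
    have := congrFun h l
    simp [hq.symm] at this
    omega
  · simp

end Coefficients

/-! ### Holomorphic dependence on initial values and the Schwarz lemma for flows. -/

section Flow

open Metric Filter Set

variable {n : ℕ}

theorem polydisk_eq_ball {ρ : ℝ} (hρ : 0 < ρ) : polydisk n ρ = ball 0 ρ := by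
  ext z
  simp [polydisk, pi_norm_lt_iff hρ]

theorem isOpen_polydisk (ρ : ℝ) : IsOpen (polydisk n ρ) := by
  have : polydisk n ρ = ⋂ l, {z | ‖z l‖ < ρ} := by ext; simp [polydisk]
  rw [this]
  exact isOpen_iInter_of_finite fun l => isOpen_lt (by fun_prop) continuous_const

/-- First order Taylor expansion, uniformly along a compact set. -/
theorem exists_uniform_linearization {U K : Set (Fin n → ℂ)} (hU : IsOpen U)
    {F : (Fin n → ℂ) → (Fin n → ℂ)} (hF : DifferentiableOn ℂ F U) (hK : IsCompact K)
    (hKU : K ⊆ U) : ∃ M ≥ 0, (∀ x ∈ K, ‖fderiv ℂ F x‖ ≤ M) ∧ ∀ η > 0, ∃ δ > 0, ∀ x ∈ K, ∀ y,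
      ‖y - x‖ ≤ δ → ‖F y - F x - fderiv ℂ F x (y - x)‖ ≤ η * ‖y - x‖ := by
  obtain ⟨δ0, hδ0, hsub⟩ := hK.exists_cthickening_subset_open hU hKU
  have hK' : IsCompact (cthickening δ0 K) := hK.cthickening
  have hcont := continuousOn_fderiv_of_differentiableOn hU hF
  obtain ⟨M, hM⟩ := (hK.image_of_continuousOn (hcont.mono hKU)).isBounded.exists_norm_le
  have hunif := hK'.uniformContinuousOn_of_continuous (hcont.mono hsub)
  refine ⟨max M 0, le_max_right _ _, fun x hx => (hM _ (mem_image_of_mem _ hx)).trans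
    (le_max_left _ _), fun η hη => ?_⟩
  obtain ⟨δ1, hδ1, h1⟩ := Metric.uniformContinuousOn_iff.1 hunif η hη
  refine ⟨min δ0 (δ1 / 2), by positivity, fun x hx y hy => ?_⟩
  have hmem : ∀ z ∈ closedBall x (min δ0 (δ1 / 2)), z ∈ cthickening δ0 K := fun z hz =>
    mem_cthickening_of_dist_le z x δ0 K hx (hz.trans (min_le_left _ _))
  refine (convex_closedBall x (min δ0 (δ1 / 2))).norm_image_sub_le_of_norm_fderiv_le'
    (𝕜 := ℂ) (fun z hz => hF.differentiableAt (hU.mem_nhds (hsub (hmem z hz))))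
    (fun z hz => ?_) (mem_closedBall_self (by positivity)) (by rwa [mem_closedBall, dist_eq_norm])
  rw [← dist_eq_norm]
  refine (h1 z (hmem z hz) x (hmem x (mem_closedBall_self (by positivity))) ?_).le
  have : dist z x ≤ min δ0 (δ1 / 2) := hz
  linarith [this.trans (min_le_right _ _)]

/-- `x` solves `ẋ = F(x)` on `[0, T]`. -/
structure IsSolution (F : (Fin n → ℂ) → (Fin n → ℂ)) (T : ℝ) (x : ℝ → (Fin n → ℂ)) : Prop where
  continuousOn : ContinuousOn x (Icc 0 T)
  deriv : ∀ t ∈ Ico 0 T, HasDerivWithinAt x (F (x t)) (Ici t) t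

/-- Lipschitz dependence of solutions on the initial value. -/
theorem IsSolution.exists_norm_sub_le {U : Set (Fin n → ℂ)} (hU : IsOpen U)
    {F : (Fin n → ℂ) → (Fin n → ℂ)} (hF : DifferentiableOn ℂ F U) {T : ℝ}
    {x : ℝ → (Fin n → ℂ)} (hx : IsSolution F T x) (hxU : MapsTo x (Icc 0 T) U) :
    ∃ C > 0, ∃ δ > 0, ∀ y, IsSolution F T y → ∀ κ, 0 < κ → κ ≤ δ → ‖y 0 - x 0‖ ≤ κ →
      ∀ t ∈ Icc 0 T, ‖y t - x t‖ ≤ C * κ := by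
  have hK : IsCompact (x '' Icc 0 T) := isCompact_Icc.image_of_continuousOn hx.continuousOn
  obtain ⟨M, hM0, hM, hlin⟩ := exists_uniform_linearization hU hF hK hxU.image_subset
  obtain ⟨δ, hδ, h1⟩ := hlin 1 one_pos
  refine ⟨Real.exp ((M + 2) * T), Real.exp_pos _, δ / Real.exp ((M + 2) * T), by positivity,
    fun y hy κ hκ hκδ h0 t ht => ?_⟩
  rw [le_div_iff₀ (Real.exp_pos _)] at hκδ
  have hmono : ∀ s ∈ Icc 0 T, κ * Real.exp ((M + 2) * s) ≤ κ * Real.exp ((M + 2) * T) := by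
    intro s hs
    have := hs.2
    gcongr
  -- The barrier stays below `δ` up to time `T`, so where the distance meets it the linearization
  -- holds and gives rate `M + 1`. The exponent `M + 2` makes the comparison strict. Thus `y` need
  -- not be known to stay in `U`.
  have key := image_norm_le_of_norm_deriv_right_lt_deriv_boundary (f := fun t => y t - x t)
    (f' := fun t => F (y t) - F (x t)) (a := 0) (b := T)
    (B := fun t => κ * Real.exp ((M + 2) * t)) (B' := fun t => (M + 2) * (κ * Real.exp ((M + 2) * t)))
    (hy.continuousOn.sub hx.continuousOn) (fun t ht => (hy.deriv t ht).sub (hx.deriv t ht))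
    (by simpa using h0) (fun t => by
      have := (((hasDerivAt_id t).const_mul (M + 2)).exp).const_mul κ
      refine this.congr_deriv ?_
      simp
      ring) (fun s hs hB => by
      have hsI : s ∈ Icc 0 T := Ico_subset_Icc_self hs
      have hBpos : 0 < κ * Real.exp ((M + 2) * s) := by positivity
      have hle : ‖y s - x s‖ ≤ δ := by
        rw [hB]
        exact (hmono s hsI).trans hκδ
      have h2 := h1 (x s) (mem_image_of_mem _ hsI) (y s) hle
      have h3 := (fderiv ℂ F (x s)).le_of_opNorm_le (hM _ (mem_image_of_mem _ hsI)) (y s - x s)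
      have h4 : ‖F (y s) - F (x s)‖ ≤ (M + 1) * ‖y s - x s‖ := by
        have := norm_add_le (F (y s) - F (x s) - fderiv ℂ F (x s) (y s - x s))
          (fderiv ℂ F (x s) (y s - x s))
        rw [sub_add_cancel] at this
        linarith
      rw [hB] at h4
      change _ < (M + 2) * (κ * Real.exp ((M + 2) * s))
      linarith) ht
  calc ‖y t - x t‖ ≤ κ * Real.exp ((M + 2) * t) := key
    _ ≤ _ := hmono t ht
    _ = _ := mul_comm _ _

/-- Uniqueness follows from the Lipschitz estimate, since equal initial values allow every small
`κ`. -/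
theorem IsSolution.eqOn {U : Set (Fin n → ℂ)} (hU : IsOpen U)
    {F : (Fin n → ℂ) → (Fin n → ℂ)} (hF : DifferentiableOn ℂ F U) {T : ℝ}
    {x y : ℝ → (Fin n → ℂ)} (hx : IsSolution F T x) (hxU : MapsTo x (Icc 0 T) U)
    (hy : IsSolution F T y) (h0 : y 0 = x 0) : EqOn y x (Icc 0 T) := by
  intro t ht
  obtain ⟨C, hC, δ, hδ, h⟩ := hx.exists_norm_sub_le hU hF hxU
  rw [← sub_eq_zero, ← norm_le_zero_iff]
  refine le_of_forall_pos_le_add fun η hη => ?_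
  have hκ : 0 < min δ (η / C) := by positivity
  have := h y hy _ hκ (min_le_left _ _) (by simpa [h0] using hκ.le) t ht
  have h2 : C * min δ (η / C) ≤ η := by
    calc C * min δ (η / C) ≤ C * (η / C) := by gcongr; exact min_le_right _ _
      _ = η := by field_simp
  linarith

/-- Solutions with initial values on a complex line depend holomorphically on the parameter. -/
theorem differentiableAt_of_isSolution {U : Set (Fin n → ℂ)} (hU : IsOpen U)
    {F : (Fin n → ℂ) → (Fin n → ℂ)} (hF : DifferentiableOn ℂ F U) {T : ℝ} (hT : 0 ≤ T)
    {γ : ℂ → ℝ → (Fin n → ℂ)} {v : Fin n → ℂ} (hγ : ∀ᶠ ζ in 𝓝 0, IsSolution F T (γ ζ))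
    (hv : ∀ᶠ ζ in 𝓝 0, γ ζ 0 = γ 0 0 + ζ • v) (hγU : MapsTo (γ 0) (Icc 0 T) U) :
    DifferentiableAt ℂ (fun ζ => γ ζ T) 0 := by
  have hx : IsSolution F T (γ 0) := hγ.self_of_nhds
  have hK : IsCompact (γ 0 '' Icc 0 T) := isCompact_Icc.image_of_continuousOn hx.continuousOn
  obtain ⟨M, hM0, hM, hlin⟩ := exists_uniform_linearization hU hF hK hγU.image_subset
  obtain ⟨C, hC, δ, hδ, hlip⟩ := hx.exists_norm_sub_le hU hF hγU
  -- The added `1` keeps the admissible distance `‖ζ‖ * V` positive even if `v = 0`.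
  set V := ‖v‖ + 1 with hV
  have hVpos : 0 < V := by positivity
  have hsmall : ∀ η > 0, ∀ᶠ ζ : ℂ in 𝓝[≠] 0, ‖ζ‖ * V < η := by
    intro η hη
    have : Tendsto (fun ζ : ℂ => ‖ζ‖ * V) (𝓝 0) (𝓝 0) := by
      have : Continuous fun ζ : ℂ => ‖ζ‖ * V := by fun_prop
      simpa using this.tendsto 0
    exact (this.eventually (gt_mem_nhds hη)).filter_mono nhdsWithin_le_nhds
  -- The difference quotients all start at `v` and solve the linearized equation along `γ 0` up to
  -- an error that tends to `0` with `ζ`.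
  let q : ℂ → ℝ → (Fin n → ℂ) := fun ζ t => ζ⁻¹ • (γ ζ t - γ 0 t)
  have hq : ∀ η > 0, ∀ᶠ ζ : ℂ in 𝓝[≠] 0, q ζ 0 = v ∧ ContinuousOn (q ζ) (Icc 0 T) ∧
      ∀ t ∈ Ico 0 T, ∃ q', HasDerivWithinAt (q ζ) q' (Ici t) t ∧
        ‖q' - fderiv ℂ F (γ 0 t) (q ζ t)‖ ≤ η * (C * V) := by
    intro η hη
    obtain ⟨δ1, hδ1, h1⟩ := hlin η hη
    filter_upwards [hγ.filter_mono nhdsWithin_le_nhds, hv.filter_mono nhdsWithin_le_nhds,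
      self_mem_nhdsWithin, hsmall δ hδ, hsmall (δ1 / C) (by positivity)] with ζ hs h0 hne hs1 hs2
    have hne : ζ ≠ 0 := hne
    have hpos : 0 < ‖ζ‖ := norm_pos_iff.2 hne
    have hb : ∀ t ∈ Icc 0 T, ‖γ ζ t - γ 0 t‖ ≤ C * (‖ζ‖ * V) :=
      hlip (γ ζ) hs (‖ζ‖ * V) (by positivity) hs1.le (by
        rw [h0, add_sub_cancel_left, norm_smul]
        gcongr
        linarith)
    refine ⟨?_, (hs.continuousOn.fun_sub hx.continuousOn).fun_const_smul ζ⁻¹, fun t ht =>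
      ⟨ζ⁻¹ • (F (γ ζ t) - F (γ 0 t)), ((hs.deriv t ht).fun_sub (hx.deriv t ht)).fun_const_smul ζ⁻¹, ?_⟩⟩
    · simp only [q]
      rw [h0, add_sub_cancel_left, smul_smul, inv_mul_cancel₀ hne, one_smul]
    · have htI := Ico_subset_Icc_self ht
      simp only [q]
      rw [map_smul, ← smul_sub, norm_smul, norm_inv]
      have hd1 : ‖γ ζ t - γ 0 t‖ ≤ δ1 := by
        refine (hb t htI).trans ?_
        rw [lt_div_iff₀ hC] at hs2
        linarith
      calc ‖ζ‖⁻¹ * ‖F (γ ζ t) - F (γ 0 t) - fderiv ℂ F (γ 0 t) (γ ζ t - γ 0 t)‖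
          ≤ ‖ζ‖⁻¹ * (η * ‖γ ζ t - γ 0 t‖) := by
            gcongr
            exact h1 _ (mem_image_of_mem _ htI) _ hd1
        _ ≤ ‖ζ‖⁻¹ * (η * (C * (‖ζ‖ * V))) := by
            gcongr
            exact hb t htI
        _ = η * (C * V) := by field_simp
  -- Grönwall's inequality bounds the difference of two such quotients, so completeness gives the
  -- limit without solving the variational equation.
  have hcauchy : Cauchy (map (fun ζ => q ζ T) (𝓝[≠] (0 : ℂ))) := by
    rw [Metric.cauchy_iff]
    refine ⟨inferInstance, fun ε hε => ?_⟩
    have hlim : Tendsto (fun e => gronwallBound 0 M e T) (𝓝 0) (𝓝 0) := by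
      have := (gronwallBound_continuous_ε 0 M T).tendsto 0
      rwa [gronwallBound_ε0_δ0] at this
    have hlim2 : ∀ᶠ e in 𝓝[>] (0 : ℝ), gronwallBound 0 M e T < ε :=
      (hlim.eventually (gt_mem_nhds hε)).filter_mono nhdsWithin_le_nhds
    obtain ⟨e, he, hepos⟩ := (hlim2.and self_mem_nhdsWithin).exists
    have hepos : 0 < e := hepos
    refine ⟨_, image_mem_map (hq (e / (2 * (C * V))) (by positivity)), ?_⟩
    rintro _ ⟨ζ, ⟨hζ0, hζc, hζ⟩, rfl⟩ _ ⟨ξ, ⟨hξ0, hξc, hξ⟩, rfl⟩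
    have hη : e / (2 * (C * V)) * (C * V) = e / 2 := by field_simp
    rw [hη] at hζ hξ
    choose! a ha ha2 using hζ
    choose! b hb hb2 using hξ
    have := norm_le_gronwallBound_of_norm_deriv_right_le (f := fun t => q ζ t - q ξ t)
      (f' := fun t => a t - b t) (δ := 0) (K := M) (ε := e) (hζc.sub hξc)
      (fun t ht => (ha t ht).sub (hb t ht)) (by simp [hζ0, hξ0]) (fun t ht => by
        have e1 : a t - b t = (a t - fderiv ℂ F (γ 0 t) (q ζ t)) - (b t - fderiv ℂ F (γ 0 t) (q ξ t))
            + fderiv ℂ F (γ 0 t) (q ζ t - q ξ t) := by rw [map_sub]; abel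
        rw [e1]
        have h3 := (fderiv ℂ F (γ 0 t)).le_of_opNorm_le
          (hM _ (mem_image_of_mem _ (Ico_subset_Icc_self ht))) (q ζ t - q ξ t)
        have h4 := norm_add_le ((a t - fderiv ℂ F (γ 0 t) (q ζ t))
          - (b t - fderiv ℂ F (γ 0 t) (q ξ t))) (fderiv ℂ F (γ 0 t) (q ζ t - q ξ t))
        have h5 := norm_sub_le (a t - fderiv ℂ F (γ 0 t) (q ζ t))
          (b t - fderiv ℂ F (γ 0 t) (q ξ t))
        linarith [ha2 t ht, hb2 t ht]) T (right_mem_Icc.2 hT)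
    rw [sub_zero] at this
    rw [dist_eq_norm]
    exact this.trans_lt he
  obtain ⟨A, hA⟩ := cauchy_map_iff_exists_tendsto.1 hcauchy
  have : HasDerivAt (fun ζ => γ ζ T) A 0 := by
    rw [hasDerivAt_iff_tendsto_slope_zero]
    simpa [q] using hA
  exact this.differentiableAt

theorem IsForwardFlow.isSolution {X : Set (Fin n → ℂ)} {F : (Fin n → ℂ) → (Fin n → ℂ)}
    {φ : ℝ → (Fin n → ℂ) → (Fin n → ℂ)} (hφ : IsForwardFlow X F φ) {z : Fin n → ℂ} (hz : z ∈ X)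
    (T : ℝ) : IsSolution F T (fun t => φ t z) where
  continuousOn t ht := (hφ.deriv z hz t ht.1).continuousWithinAt.mono Icc_subset_Ici_self
  deriv t ht := (hφ.deriv z hz t ht.1).mono (Ici_subset_Ici.2 ht.1)

theorem IsForwardFlow.eqOn {X : Set (Fin n → ℂ)} (hX : IsOpen X)
    {F : (Fin n → ℂ) → (Fin n → ℂ)} (hF : DifferentiableOn ℂ F X)
    {φ : ℝ → (Fin n → ℂ) → (Fin n → ℂ)} (hφ : IsForwardFlow X F φ) {T : ℝ}
    {y : ℝ → (Fin n → ℂ)} (hy : IsSolution F T y) (h0 : y 0 ∈ X) :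
    EqOn y (fun t => φ t (y 0)) (Icc 0 T) :=
  (hφ.isSolution h0 T).eqOn hX hF (fun t ht => hφ.mapsTo t ht.1 h0) hy (hφ.zero _ h0).symm

/-- A forward flow of holomorphic vector fields that fixes `0` and preserves a polydisk does not
increase the maximum norm there. -/
theorem IsForwardFlow.norm_le {F : (Fin n → ℂ) → (Fin n → ℂ)}
    (hF : DifferentiableOn ℂ F (polydisk n 1)) {φ : ℝ → (Fin n → ℂ) → (Fin n → ℂ)}
    (hφ : IsForwardFlow (polydisk n 1) F φ) (hF0 : F 0 = 0) {ρ : ℝ} (hρ0 : 0 < ρ) (hρ1 : ρ ≤ 1)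
    (hinv : ∀ t, 0 ≤ t → MapsTo (φ t) (polydisk n ρ) (polydisk n ρ)) {z : Fin n → ℂ}
    (hz : ‖z‖ < ρ) {t : ℝ} (ht : 0 ≤ t) : ‖φ t z‖ ≤ ‖z‖ := by
  have hX : IsOpen (polydisk n 1) := isOpen_polydisk 1
  rw [polydisk_eq_ball hρ0] at hinv
  have hsub : ball (0 : Fin n → ℂ) ρ ⊆ polydisk n 1 := by
    rw [polydisk_eq_ball one_pos]
    exact ball_subset_ball hρ1
  have h0X : (0 : Fin n → ℂ) ∈ polydisk n 1 := hsub (mem_ball_self hρ0)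
  have hzero : φ t 0 = 0 := by
    have hy : IsSolution F t (fun _ => (0 : Fin n → ℂ)) :=
      ⟨continuousOn_const, fun s _ => by rw [hF0]; exact hasDerivWithinAt_const _ _ _⟩
    exact (hφ.eqOn hX hF hy h0X (right_mem_Icc.2 ht)).symm
  rcases eq_or_ne z 0 with rfl | hz0
  · rw [hzero]
  have hzpos : 0 < ‖z‖ := norm_pos_iff.2 hz0
  have hmem : ∀ ζ ∈ ball (0 : ℂ) (ρ / ‖z‖), ζ • z ∈ ball (0 : Fin n → ℂ) ρ := by
    intro ζ hζ
    rw [mem_ball_zero_iff] at hζ ⊢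
    rwa [norm_smul, ← lt_div_iff₀ hzpos]
  have hd : DifferentiableOn ℂ (fun ζ : ℂ => φ t (ζ • z)) (ball 0 (ρ / ‖z‖)) := by
    intro ζ₀ hζ₀
    refine DifferentiableAt.differentiableWithinAt ?_
    -- The parameter is recentred at `ζ₀`, as `differentiableAt_of_isSolution` concerns the
    -- parameter value `0`.
    have h1 : DifferentiableAt ℂ (fun ζ : ℂ => φ t ((ζ₀ + ζ) • z)) 0 := by
      have hnear : ∀ᶠ ζ : ℂ in 𝓝 0, ζ₀ + ζ ∈ ball (0 : ℂ) (ρ / ‖z‖) := by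
        have : Tendsto (fun ζ : ℂ => ζ₀ + ζ) (𝓝 0) (𝓝 ζ₀) := by
          have : Continuous fun ζ : ℂ => ζ₀ + ζ := by fun_prop
          simpa using this.tendsto 0
        exact this.eventually (isOpen_ball.mem_nhds hζ₀)
      have hX' : ∀ᶠ ζ : ℂ in 𝓝 0, (ζ₀ + ζ) • z ∈ polydisk n 1 :=
        hnear.mono fun ζ hζ => hsub (hmem _ hζ)
      have h00 := hX'.self_of_nhds
      refine differentiableAt_of_isSolution hX hF ht (γ := fun ζ s => φ s ((ζ₀ + ζ) • z)) (v := z)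
        (hX'.mono fun ζ hζ => hφ.isSolution hζ t) (hX'.mono fun ζ hζ => ?_)
        fun s hs => hφ.mapsTo s hs.1 h00
      rw [hφ.zero _ hζ, hφ.zero _ h00, add_zero, add_smul]
    have h2 : DifferentiableAt ℂ (fun ζ : ℂ => ζ - ζ₀) ζ₀ := by fun_prop
    have h3 := DifferentiableAt.comp ζ₀ (g := fun ζ : ℂ => φ t ((ζ₀ + ζ) • z))
      (by simpa using h1) h2
    simpa [Function.comp_def] using h3
  -- The disc of radius `ρ / ‖z‖` is the part of the line through `z` inside the polydisk. Since
  -- `‖z‖ < ρ` it contains `ζ = 1`, where the Schwarz bound is exactly `‖z‖`.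
  have hschwarz := Complex.dist_le_div_mul_dist_of_mapsTo_ball (R₂ := ρ) (z := 1) hd
    (fun ζ hζ => by
      simp only [zero_smul, hzero]
      exact ball_subset_closedBall (hinv t ht (hmem ζ hζ)))
    (by rw [mem_ball_zero_iff, norm_one, one_lt_div hzpos]; exact hz)
  simp only [zero_smul, hzero, one_smul, dist_zero_right, norm_one, mul_one] at hschwarz
  calc ‖φ t z‖ ≤ ρ / (ρ / ‖z‖) := hschwarz
    _ = ‖z‖ := by field_simp

end Flow

/-! ### Lie's theorem and simultaneous triangularization. -/

section Triangularization

open Module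

/-- Lie's theorem: a solvable Lie algebra acts by upper triangular matrices in a suitable basis. -/
theorem exists_triangular_basis {L : Type*} [LieRing L] [LieAlgebra ℂ L] [LieAlgebra.IsSolvable L]
    (n : ℕ) (V : Type*) [AddCommGroup V] [Module ℂ V] [FiniteDimensional ℂ V] [LieRingModule L V]
    [LieModule ℂ L V] (hn : finrank ℂ V = n) :
    ∃ b : Basis (Fin n) ℂ V, ∀ (x : L) (i j : Fin n), j < i → b.repr ⁅x, b j⁆ i = 0 := by
  induction n generalizing V with
  | zero => exact ⟨finBasisOfFinrankEq ℂ V hn, fun x i => i.elim0⟩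
  | succ n ih =>
    have : Nontrivial V := Module.nontrivial_of_finrank_pos (R := ℂ) (by omega)
    -- A common eigenvector `v` spans an invariant line. A triangular basis of the quotient, lifted
    -- and preceded by `v`, is triangular.
    obtain ⟨χ, hχ⟩ := LieModule.exists_nontrivial_weightSpace_of_isSolvable ℂ L V
    obtain ⟨⟨v, hv⟩, hv0⟩ := exists_ne (0 : LieModule.weightSpace V χ)
    have hv0 : v ≠ 0 := fun h => hv0 (Subtype.ext h)
    rw [LieModule.mem_weightSpace] at hv
    let N : LieSubmodule ℂ L V :=
      { ℂ ∙ v with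
        lie_mem := by
          intro x m hm
          obtain ⟨c, rfl⟩ := Submodule.mem_span_singleton.1 hm
          rw [lie_smul, hv]
          exact Submodule.smul_mem _ _ (Submodule.smul_mem _ _ (Submodule.mem_span_singleton_self v)) }
    have hN : N.toSubmodule = ℂ ∙ v := rfl
    let Q := V ⧸ N
    let mk : V →ₗ[ℂ] Q := N.toSubmodule.mkQ
    have hker : ∀ y, mk y = 0 ↔ y ∈ ℂ ∙ v := fun y => Submodule.Quotient.mk_eq_zero _
    have hrank : finrank ℂ Q = n := by
      have h1 := Submodule.finrank_quotient_add_finrank N.toSubmodule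
      rw [hN, finrank_span_singleton hv0] at h1
      have h2 : finrank ℂ (V ⧸ (ℂ ∙ v)) = n := by omega
      exact h2
    have : FiniteDimensional ℂ Q := inferInstanceAs (FiniteDimensional ℂ (V ⧸ N.toSubmodule))
    obtain ⟨c, hc⟩ := ih Q hrank
    have hsurj : Function.Surjective mk := Submodule.mkQ_surjective _
    choose s hs using hsurj
    let u : Fin n → V := fun i => s (c i)
    have hu : ∀ i, mk (u i) = c i := fun i => hs _
    have hLI : LinearIndependent ℂ u := by
      refine LinearIndependent.of_comp mk ?_
      have : mk ∘ u = c := funext hu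
      rw [this]
      exact c.linearIndependent
    have hnot : v ∉ Submodule.span ℂ (Set.range u) := by
      intro h
      obtain ⟨a, ha⟩ := (Submodule.mem_span_range_iff_exists_fun ℂ).1 h
      have h1 : ∑ i, a i • c i = 0 := by
        have h2 := (hker v).2 (Submodule.mem_span_singleton_self v)
        rw [← ha, map_sum] at h2
        simpa [hu] using h2
      have h2 := Fintype.linearIndependent_iff.1 c.linearIndependent a h1
      rw [← ha] at hv0
      exact hv0 (Finset.sum_eq_zero fun i _ => by rw [h2 i, zero_smul])
    let b : Basis (Fin (n + 1)) ℂ V := basisOfLinearIndependentOfCardEqFinrank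
      (linearIndependent_finCons.2 ⟨hLI, hnot⟩) (by simp [hn])
    have hb0 : b 0 = v := by simp [b]
    have hbs : ∀ i : Fin n, b i.succ = u i := by simp [b]
    -- All coordinates except the first factor through the quotient, where the induction hypothesis
    -- controls them.
    have hrepr : ∀ (y : V) (i : Fin n), b.repr y i.succ = c.repr (mk y) i := by
      intro y i
      have : (b.coord i.succ) = (c.coord i) ∘ₗ mk := by
        refine b.ext fun k => ?_
        refine Fin.cases ?_ (fun k => ?_) k
        · have h2 : mk (b 0) = 0 := by
            rw [hb0]; exact (hker v).2 (Submodule.mem_span_singleton_self v)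
          rw [LinearMap.comp_apply, h2, LinearMap.map_zero, Basis.coord_apply, Basis.repr_self]
          simp
        · rw [LinearMap.comp_apply, hbs, hu, ← hbs, Basis.coord_apply, Basis.coord_apply,
            Basis.repr_self, Basis.repr_self]
          simp [Finsupp.single_apply]
      exact LinearMap.congr_fun this y
    refine ⟨b, fun x i j hij => ?_⟩
    obtain ⟨i, rfl⟩ := Fin.exists_succ_eq.2 (Fin.ne_zero_of_lt hij)
    rw [hrepr]
    have hlie : ∀ y, mk ⁅x, y⁆ = ⁅x, mk y⁆ := fun y => rfl
    revert hij
    refine Fin.cases (fun _ => ?_) (fun j hij => ?_) j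
    · have h2 : mk v = 0 := (hker v).2 (Submodule.mem_span_singleton_self v)
      rw [hlie, hb0, h2, lie_zero, map_zero]
      rfl
    · rw [hlie, hbs, hu]
      exact hc x i j (Fin.succ_lt_succ_iff.1 hij)

attribute [local instance] LieRing.ofAssociativeRing

/-- Simultaneous triangularization of matrices that generate a solvable Lie algebra. -/
theorem exists_isUnit_blockTriangular {n m : ℕ} {A : Fin m → Matrix (Fin n) (Fin n) ℂ}
    (hA : GeneratesSolvable A) :
    ∃ P : Matrix (Fin n) (Fin n) ℂ, IsUnit P ∧ ∀ i, (P⁻¹ * A i * P).BlockTriangular id := by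
  let L := LieSubalgebra.lieSpan ℂ (Matrix (Fin n) (Fin n) ℂ) (Set.range A)
  have : LieAlgebra.IsSolvable L := hA
  obtain ⟨b, hb⟩ := exists_triangular_basis (L := L) n (Fin n → ℂ) (by simp)
  let e := Pi.basisFun ℂ (Fin n)
  let P := e.toMatrix b
  have h1 : b.toMatrix e * P = 1 := b.toMatrix_mul_toMatrix_flip e
  have h2 : P * b.toMatrix e = 1 := e.toMatrix_mul_toMatrix_flip b
  have hinv : P⁻¹ = b.toMatrix e := Matrix.inv_eq_left_inv h1
  refine ⟨P, ⟨⟨P, b.toMatrix e, h2, h1⟩, rfl⟩, fun i => ?_⟩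
  have hAi : A i ∈ L := LieSubalgebra.subset_lieSpan ⟨i, rfl⟩
  have hlie : ∀ y : Fin n → ℂ, ⁅(⟨A i, hAi⟩ : L), y⁆ = Matrix.toLin' (A i) y := fun y => by
    simp
  have key : P⁻¹ * A i * P = LinearMap.toMatrix b b (Matrix.toLin' (A i)) := by
    rw [hinv]
    have : A i = LinearMap.toMatrix e e (Matrix.toLin' (A i)) := by
      simp [e, LinearMap.toMatrix_eq_toMatrix']
    conv_lhs => rw [this]
    exact basis_toMatrix_mul_linearMap_toMatrix_mul_basis_toMatrix _ _ _ _ _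
  rw [key]
  intro k l hlk
  rw [LinearMap.toMatrix_apply, ← hlie]
  exact hb _ k l hlk

/-- Scaling `P` by `‖P⁻¹‖` normalizes the inverse and leaves all conjugates unchanged; this norm is
nonzero because `n ≥ 1`. -/
theorem exists_isNormalizedTriangularizer {n m : ℕ} [NeZero n]
    {A : Fin m → Matrix (Fin n) (Fin n) ℂ} (hA : GeneratesSolvable A) :
    ∃ P : Matrix (Fin n) (Fin n) ℂ, IsNormalizedTriangularizer A P := by
  obtain ⟨P, hP, htri⟩ := exists_isUnit_blockTriangular hA
  have hsmul : ∀ (c : ℂ) (M : Matrix (Fin n) (Fin n) ℂ), infNorm (c • M) = ‖c‖ * infNorm M := by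
    open scoped Matrix.Norms.Operator in
    exact fun c M => norm_smul c M
  have hzero : ∀ M : Matrix (Fin n) (Fin n) ℂ, infNorm M = 0 → M = 0 := by
    open scoped Matrix.Norms.Operator in
    exact fun M h => norm_eq_zero.1 h
  have hpos : ∀ M : Matrix (Fin n) (Fin n) ℂ, 0 ≤ infNorm M := by
    open scoped Matrix.Norms.Operator in
    exact fun M => norm_nonneg M
  set c := infNorm P⁻¹ with hc
  have hdet : IsUnit P.det := (Matrix.isUnit_iff_isUnit_det P).1 hP
  have hc0 : c ≠ 0 := by
    intro h
    have h1 := Matrix.nonsing_inv_mul P hdet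
    rw [hzero _ h, zero_mul] at h1
    exact zero_ne_one h1
  have hcC : (c : ℂ) ≠ 0 := by exact_mod_cast hc0
  have hinv : ((c : ℂ) • P)⁻¹ = (c : ℂ)⁻¹ • P⁻¹ := by
    refine Matrix.inv_eq_left_inv ?_
    rw [smul_mul_smul_comm, Matrix.nonsing_inv_mul P hdet, inv_mul_cancel₀ hcC, one_smul]
  refine ⟨(c : ℂ) • P, ?_, ?_, fun i => ?_⟩
  · rw [Matrix.isUnit_iff_isUnit_det, Matrix.det_smul]
    exact ((isUnit_iff_ne_zero.2 hcC).pow _).mul hdet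
  · rw [hinv, hsmul, norm_inv, Complex.norm_real, Real.norm_of_nonneg (hpos _), ← hc,
      inv_mul_cancel₀ hc0]
  · rw [hinv, smul_mul_assoc, smul_mul_smul_comm, inv_mul_cancel₀ hcC, one_smul]
    exact htri i

end Triangularization

/-! ### Negativity of the quadratic form of a dominated triangular matrix. -/

section DoubleSeries

open Filter

/-- The summand `ε_k x_k x_j |A_{kj}|` is dominated by the weighted diagonal terms. -/
theorem two_mul_le_of_crossRatio_lt {a p q β β' x y e e' : ℝ} (ha : 0 < a) (hp : 0 < p)
    (hq : 0 < q) (hβ : 0 ≤ β) (hβ' : 0 ≤ β') (hββ' : 0 < β * β')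
    (he : 0 < e) (he' : 0 < e') (h : e * (a ^ 2 / (4 * p * q) * (1 / (β * β'))) < e') :
    2 * (e * (x * a * y)) ≤ β * (2 * p * e' * y ^ 2) + β' * (2 * q * e * x ^ 2) := by
  have h1 : e * a ^ 2 < e' * (4 * p * q * (β * β')) := by
    have : e * (a ^ 2 / (4 * p * q) * (1 / (β * β'))) = e * a ^ 2 / (4 * p * q * (β * β')) := by
      field_simp
    rw [this, div_lt_iff₀ (by positivity)] at h
    exact h
  -- This is `4 s t ≤ (s + t)²` for the two terms `s`, `t` on the right; the hypothesis bounds the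
  -- square of the left side by `4 s t`.
  refine le_of_sq_le_sq ?_ (by positivity)
  have h2 : e * (e * a ^ 2) * (x * y) ^ 2 ≤ e * (e' * (4 * p * q * (β * β'))) * (x * y) ^ 2 := by
    gcongr
  nlinarith [sq_nonneg (β * (2 * p * e' * y ^ 2) - β' * (2 * q * e * x ^ 2))]

variable {ε : ℕ → ℝ} {A : ℕ → ℕ → ℂ} {b : ℕ → ℕ → ℝ} {v : ℕ → ℂ}

/-- The hypotheses on the Koopman matrix `A k j = ⟨L e_k, e_j⟩` and on the weights. -/
structure IsDominated (ε : ℕ → ℝ) (A : ℕ → ℕ → ℂ) (b : ℕ → ℕ → ℝ) : Prop where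
  eps_pos : ∀ j, 0 < ε j
  triangular : ∀ k j, j < k → A k j = 0
  diag_neg : ∀ k, (A k k).re < 0
  nonneg : ∀ j k, 0 ≤ b j k
  pos : ∀ j k, A k j ≠ 0 → 0 < b j k * b k j
  summable : ∀ j, Summable (b j)
  tsum_le : ∀ j, ∑' k, b j k ≤ 1
  lt : ∀ k j, k < j → A k j ≠ 0 → ε k * (‖A k j‖ ^ 2 / (4 * |(A j j).re| * |(A k k).re|)
      * (1 / (b j k * b k j))) < ε j

/-- The weighted diagonal term. -/
noncomputable def diagWeight (ε : ℕ → ℝ) (A : ℕ → ℕ → ℂ) (v : ℕ → ℂ) (j : ℕ) : ℝ :=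
  2 * |(A j j).re| * ε j * ‖v j‖ ^ 2

theorem IsDominated.diagWeight_nonneg (h : IsDominated ε A b) (j : ℕ) : 0 ≤ diagWeight ε A v j := by
  have := h.eps_pos j
  unfold diagWeight
  positivity

theorem IsDominated.off_diag_le (h : IsDominated ε A b) {k j : ℕ} (hkj : k < j) :
    2 * (ε k * (‖v k‖ * ‖A k j‖ * ‖v j‖))
      ≤ b j k * diagWeight ε A v j + b k j * diagWeight ε A v k := by
  by_cases hA : A k j = 0
  · have h1 := mul_nonneg (h.nonneg j k) (h.diagWeight_nonneg (v := v) j)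
    have h2 := mul_nonneg (h.nonneg k j) (h.diagWeight_nonneg (v := v) k)
    simp only [hA, norm_zero, mul_zero, zero_mul]
    linarith
  · exact two_mul_le_of_crossRatio_lt (norm_pos_iff.2 hA) (abs_pos.2 (h.diag_neg j).ne)
      (abs_pos.2 (h.diag_neg k).ne) (h.nonneg _ _) (h.nonneg _ _) (h.pos _ _ hA)
      (h.eps_pos k) (h.eps_pos j) (h.lt k j hkj hA)

theorem IsDominated.diagWeight_summable (h : IsDominated ε A b)
    (hs : Summable fun j => ‖A j j‖ * (ε j * ‖v j‖ ^ 2)) : Summable (diagWeight ε A v) := by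
  refine Summable.of_nonneg_of_le h.diagWeight_nonneg (fun j => ?_) (hs.mul_left 2)
  have h1 := Complex.abs_re_le_norm (A j j)
  have h2 := h.eps_pos j
  unfold diagWeight
  calc 2 * |(A j j).re| * ε j * ‖v j‖ ^ 2 = 2 * (|(A j j).re| * (ε j * ‖v j‖ ^ 2)) := by ring
    _ ≤ _ := by gcongr

theorem summable_weight {b : ℕ → ℕ → ℝ} {u : ℕ → ℝ} (hb : ∀ j k, 0 ≤ b j k)
    (hbs : ∀ j, Summable (b j)) (hb1 : ∀ j, ∑' k, b j k ≤ 1) (hu0 : ∀ j, 0 ≤ u j)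
    (hu : Summable u) : Summable fun p : ℕ × ℕ => b p.1 p.2 * u p.1 := by
  have h0 : (0 : ℕ × ℕ → ℝ) ≤ fun p => b p.1 p.2 * u p.1 := fun p =>
    mul_nonneg (hb _ _) (hu0 _)
  rw [summable_prod_of_nonneg h0]
  refine ⟨fun j => (hbs j).mul_right (u j), ?_⟩
  have e : (fun j => ∑' k, b j k * u j) = fun j => (∑' k, b j k) * u j :=
    funext fun j => tsum_mul_right
  change Summable fun j => ∑' k, b j k * u j
  rw [e]
  exact Summable.of_nonneg_of_le (fun j => mul_nonneg (tsum_nonneg (hb j)) (hu0 _))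
    (fun j => mul_le_of_le_one_left (hu0 _) (hb1 j)) hu

theorem IsDominated.weight_summable (h : IsDominated ε A b)
    (hs : Summable fun j => ‖A j j‖ * (ε j * ‖v j‖ ^ 2)) :
    Summable fun p : ℕ × ℕ => b p.1 p.2 * diagWeight ε A v p.1 :=
  summable_weight h.nonneg h.summable h.tsum_le h.diagWeight_nonneg (h.diagWeight_summable hs)

theorem IsDominated.tsum_weight_le (h : IsDominated ε A b)
    (hs : Summable fun j => ‖A j j‖ * (ε j * ‖v j‖ ^ 2)) :
    ∑' p : ℕ × ℕ, b p.1 p.2 * diagWeight ε A v p.1 ≤ ∑' j, diagWeight ε A v j := by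
  have hW := h.weight_summable hs
  rw [hW.tsum_prod]
  refine Summable.tsum_le_tsum (fun j => ?_) hW.prod (h.diagWeight_summable hs)
  change ∑' k, b j k * diagWeight ε A v j ≤ _
  rw [tsum_mul_right]
  exact mul_le_of_le_one_left (h.diagWeight_nonneg _) (h.tsum_le j)

theorem diag_injective : Function.Injective fun k : ℕ => (k, k) := fun _ _ h => congrArg Prod.fst h

theorem hasSum_diag {f : ℕ → ℝ} {s : ℝ} (hf : HasSum f s) :
    HasSum (fun p : ℕ × ℕ => if p.1 = p.2 then f p.1 else 0) s := by
  rw [← diag_injective.hasSum_iff]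
  · simpa [Function.comp_def] using hf
  · rintro ⟨k, j⟩ hp
    rw [if_neg]
    intro hkj
    exact hp ⟨k, Prod.ext rfl hkj⟩

theorem abs_re_conj_mul_mul_le (x y z : ℂ) :
    |((starRingEnd ℂ) x * (y * z)).re| ≤ ‖x‖ * ‖y‖ * ‖z‖ := by
  refine (Complex.abs_re_le_norm _).trans ?_
  rw [norm_mul, norm_mul, Complex.norm_conj, mul_assoc]

/-- The double series of `⟨L V, V⟩` converges absolutely. -/
theorem IsDominated.summable_prod (h : IsDominated ε A b)
    (hs : Summable fun j => ‖A j j‖ * (ε j * ‖v j‖ ^ 2)) :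
    Summable fun p : ℕ × ℕ => ε p.1 * (‖v p.1‖ * ‖A p.1 p.2‖ * ‖v p.2‖) := by
  have hW := h.weight_summable hs
  have hW' : Summable fun p : ℕ × ℕ => b p.2 p.1 * diagWeight ε A v p.2 :=
    (Equiv.prodComm ℕ ℕ).summable_iff.2 hW
  -- Entries above the diagonal are dominated by the weights and their transpose, diagonal entries
  -- by `hs`, and those below vanish.
  refine Summable.of_nonneg_of_le (fun p => ?_) (fun p => ?_)
    ((hW.add hW').add (hasSum_diag hs.hasSum).summable)
  · have := h.eps_pos p.1
    positivity
  · obtain ⟨k, j⟩ := p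
    have h1 := mul_nonneg (h.nonneg j k) (h.diagWeight_nonneg (v := v) j)
    have h2 := mul_nonneg (h.nonneg k j) (h.diagWeight_nonneg (v := v) k)
    have hε := h.eps_pos k
    rcases lt_trichotomy k j with hkj | hkj | hkj
    · have h3 := h.off_diag_le (v := v) hkj
      have h4 : 0 ≤ ε k * (‖v k‖ * ‖A k j‖ * ‖v j‖) := by positivity
      simp only [if_neg hkj.ne]
      linarith
    · subst hkj
      simp only [if_true]
      have : ε k * (‖v k‖ * ‖A k k‖ * ‖v k‖) = ‖A k k‖ * (ε k * ‖v k‖ ^ 2) := by ring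
      linarith
    · simp only [h.triangular k j hkj, norm_zero, mul_zero, zero_mul, if_neg hkj.ne']
      linarith

/-- The double series of `⟨L V, V⟩` is negative. -/
theorem IsDominated.tsum_neg (h : IsDominated ε A b)
    (hs : Summable fun j => ‖A j j‖ * (ε j * ‖v j‖ ^ 2)) (hv : ∃ j, v j ≠ 0) :
    ∑' p : ℕ × ℕ, 2 * (ε p.1 * ((starRingEnd ℂ) (v p.1) * (A p.1 p.2 * v p.2)).re) < 0 := by
  set u := diagWeight ε A v with hu
  have hu0 : ∀ j, 0 ≤ u j := h.diagWeight_nonneg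
  have hus : Summable u := h.diagWeight_summable hs
  set W : ℕ × ℕ → ℝ := fun p => b p.1 p.2 * u p.1 with hWdef
  have hW : Summable W := h.weight_summable hs
  have hW0 : ∀ p, 0 ≤ W p := fun p => mul_nonneg (h.nonneg _ _) (hu0 _)
  -- Each entry above the diagonal is charged to `W` at its own position and at the transposed one.
  -- Reflecting `low` to `low'` places both charges at the same index, so the charges exhaust `W`
  -- except for its diagonal.
  let up : ℕ × ℕ → ℝ := fun p => if p.1 < p.2 then W p else 0
  let low : ℕ × ℕ → ℝ := fun p => if p.2 < p.1 then W p else 0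
  let low' : ℕ × ℕ → ℝ := fun p => if p.1 < p.2 then W p.swap else 0
  let dg : ℕ × ℕ → ℝ := fun p => if p.1 = p.2 then W (p.1, p.1) else 0
  have hup : Summable up := Summable.of_nonneg_of_le
    (fun p => by simp only [up]; split_ifs; exacts [hW0 _, le_rfl])
    (fun p => by simp only [up]; split_ifs; exacts [le_rfl, hW0 _]) hW
  have hlow : Summable low := Summable.of_nonneg_of_le
    (fun p => by simp only [low]; split_ifs; exacts [hW0 _, le_rfl])
    (fun p => by simp only [low]; split_ifs; exacts [le_rfl, hW0 _]) hW
  have hlow'eq : low' = low ∘ Equiv.prodComm ℕ ℕ := by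
    funext p; simp [low', low]
  have hlow' : Summable low' := by
    rw [hlow'eq]; exact (Equiv.prodComm ℕ ℕ).summable_iff.2 hlow
  have hlow'sum : ∑' p, low' p = ∑' p, low p := by
    rw [hlow'eq]; exact (Equiv.prodComm ℕ ℕ).tsum_eq low
  have hdiagW : Summable fun k => W (k, k) := hW.comp_injective diag_injective
  have hdg := hasSum_diag hdiagW.hasSum
  have hdecomp : W = fun p => up p + low p + dg p := by
    funext ⟨k, j⟩
    simp only [up, low, dg]
    rcases lt_trichotomy k j with hkj | hkj | hkj
    · simp [hkj, hkj.not_gt, hkj.ne]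
    · subst hkj; simp
    · simp [hkj, hkj.not_gt, hkj.ne']
  have hWsum : ∑' p, W p = ∑' p, up p + ∑' p, low p + ∑' k, W (k, k) := by
    conv_lhs => rw [hdecomp]
    rw [(hup.add hlow).tsum_add hdg.summable, hup.tsum_add hlow, hdg.tsum_eq]
  have hdu := hasSum_diag hus.hasSum
  have hT : Summable fun p : ℕ × ℕ =>
      2 * (ε p.1 * ((starRingEnd ℂ) (v p.1) * (A p.1 p.2 * v p.2)).re) := by
    refine Summable.of_norm_bounded ((h.summable_prod hs).mul_left 2) fun p => ?_
    rw [Real.norm_eq_abs, abs_mul, abs_mul, abs_of_pos (h.eps_pos _), abs_two]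
    have := h.eps_pos p.1
    have := abs_re_conj_mul_mul_le (v p.1) (A p.1 p.2) (v p.2)
    gcongr
  have hle : ∑' p : ℕ × ℕ, 2 * (ε p.1 * ((starRingEnd ℂ) (v p.1) * (A p.1 p.2 * v p.2)).re)
      ≤ ∑' p, up p + ∑' p, low' p - ∑' k, u k := by
    rw [← hup.tsum_add hlow', ← hdu.tsum_eq, ← (hup.add hlow').tsum_sub hdu.summable]
    refine hT.tsum_le_tsum (fun p => ?_) ((hup.add hlow').sub hdu.summable)
    obtain ⟨k, j⟩ := p
    rcases lt_trichotomy k j with hkj | hkj | hkj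
    · simp only [up, low', if_pos hkj, if_neg hkj.ne, sub_zero, Prod.swap_prod_mk]
      have h1 := h.off_diag_le (v := v) hkj
      have h2 := (le_abs_self _).trans (abs_re_conj_mul_mul_le (v k) (A k j) (v j))
      have h3 := mul_le_mul_of_nonneg_left h2 (h.eps_pos k).le
      simp only [W]
      linarith
    · subst hkj
      simp only [up, low', lt_irrefl, if_false, if_true, hu, diagWeight]
      have : (starRingEnd ℂ) (v k) * (A k k * v k) = A k k * (‖v k‖ ^ 2 : ℝ) := by
        rw [← Complex.normSq_eq_norm_sq, Complex.normSq_eq_conj_mul_self]; ring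
      rw [this, Complex.re_mul_ofReal, abs_of_neg (h.diag_neg k)]
      apply le_of_eq
      ring
    · simp only [up, low', if_neg hkj.not_gt, if_neg hkj.ne', h.triangular k j hkj]
      simp
  have hWle : ∑' p, W p ≤ ∑' j, u j := h.tsum_weight_le hs
  -- The uncharged diagonal of `W` makes the inequality strict: `A j j ≠ 0` forces `b j j * b j j >
  -- 0`.
  have hpos : 0 < ∑' k, W (k, k) := by
    obtain ⟨j, hj⟩ := hv
    refine hdiagW.tsum_pos (fun k => hW0 _) j ?_
    have h1 : A j j ≠ 0 := fun h0 => by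
      have := h.diag_neg j
      rw [h0] at this
      simp at this
    have h2 : 0 < b j j := by nlinarith [h.pos j j h1, h.nonneg j j]
    have h3 := h.eps_pos j
    have h4 : 0 < ‖v j‖ := norm_pos_iff.2 hj
    have h5 : 0 < |(A j j).re| := abs_pos.2 (h.diag_neg j).ne
    simp only [W, hu, diagWeight]
    positivity
  linarith

end DoubleSeries

/-! ### Absolutely convergent Taylor series on convex domains. -/

section Expansion

open Filter Metric Finset

variable {n : ℕ}

theorem hasSum_fiber_degree {E : Type*} [NormedAddCommGroup E] [CompleteSpace E]
    {f : (Fin n → ℕ) → E} {a : E} (hf : HasSum f a) :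
    HasSum (fun d => ∑ β ∈ piAntidiag univ d, f β) a := by
  have h := hf.tsum_fiberwise (fun β => degree β)
  have e : (fun d => ∑' β : (fun β : Fin n → ℕ => degree β) ⁻¹' {d}, f β)
      = fun d => ∑ β ∈ piAntidiag univ d, f β := by
    funext d
    have hs : (fun β : Fin n → ℕ => degree β) ⁻¹' {d}
        = ((piAntidiag univ d : Finset (Fin n → ℕ)) : Set (Fin n → ℕ)) := by
      ext β
      simp only [Set.mem_preimage, Set.mem_singleton_iff, Finset.mem_coe, mem_piAntidiag_univ]
    rw [hs]
    exact Finset.tsum_subtype' _ f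
  rwa [e] at h

/-- If the Taylor series at `0` of a function holomorphic on a convex domain converges absolutely
at a point of this domain, then it converges to the value of the function. -/
theorem hasSum_taylorCoeff [NeZero n] {U : Set (Fin n → ℂ)} (hU : IsOpen U) (hconv : Convex ℝ U)
    (h0 : 0 ∈ U) {g : (Fin n → ℂ) → ℂ} (hg : DifferentiableOn ℂ g U) {w : Fin n → ℂ} (hw : w ∈ U)
    (hs : Summable fun j => ‖taylorCoeff g (monomialEnum n j) * monomial (monomialEnum n j) w‖) :
    HasSum (fun j => taylorCoeff g (monomialEnum n j) * monomial (monomialEnum n j) w) (g w) := by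
  let enum : ℕ ≃ (Fin n → ℕ) := Equiv.ofBijective _ (monomialEnum_bijective n)
  let f : (Fin n → ℕ) → ℂ := fun β => taylorCoeff g β * monomial β w
  have hsβ : Summable fun β => ‖f β‖ := enum.summable_iff.1 hs
  have hth : ∀ d, taylorHomogeneous g d w = ∑ β ∈ piAntidiag univ d, f β := fun d => rfl
  set u : ℕ → ℝ := fun d => ∑ β ∈ piAntidiag univ d, ‖f β‖ with hu
  have husum : Summable u := (hasSum_fiber_degree hsβ.hasSum).summable
  have hle : ∀ d, ‖taylorHomogeneous g d w‖ ≤ u d := fun d => by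
    rw [hth]; exact norm_sum_le _ _
  have hle' : ∀ (d : ℕ) (ζ : ℂ), ζ ∈ closedBall (0 : ℂ) 1 →
      ‖taylorHomogeneous g d w * ζ ^ d‖ ≤ u d := by
    intro d ζ hζ
    rw [mem_closedBall_zero_iff] at hζ
    rw [norm_mul, norm_pow]
    exact (mul_le_of_le_one_right (norm_nonneg _) (pow_le_one₀ (norm_nonneg _) hζ)).trans (hle d)
  -- Along the line through `w` the series, grouped by degree, is holomorphic in the open unit disc
  -- and continuous up to the boundary point `ζ = 1`, where its value is wanted.
  let G : ℂ → ℂ := fun ζ => ∑' d, taylorHomogeneous g d w * ζ ^ d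
  have hGd : DifferentiableOn ℂ G (ball 0 1) := Complex.differentiableOn_tsum_of_summable_norm husum
    (fun d => by fun_prop) isOpen_ball fun d ζ hζ => hle' d ζ (ball_subset_closedBall hζ)
  have hGc : ContinuousOn G (closedBall 0 1) := continuousOn_tsum
    (fun d => by fun_prop) husum fun d ζ hζ => hle' d ζ hζ
  set V : Set ℂ := {ζ : ℂ | ζ • w ∈ U} with hV
  have hVo : IsOpen V := hU.preimage (by fun_prop)
  have hVc : Convex ℝ V := by
    intro x hx y hy a b ha hb hab
    have := hconv hx hy ha hb hab
    simp only [hV, Set.mem_ofPred_eq] at this ⊢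
    convert! this using 1
    ext i
    simp
    ring
  have hV0 : (0 : ℂ) ∈ V := by simpa [hV] using h0
  have hV1 : (1 : ℂ) ∈ V := by simpa [hV] using hw
  have hhd : DifferentiableOn ℂ (fun ζ : ℂ => g (ζ • w)) V :=
    hg.comp (by fun_prop) fun ζ hζ => hζ
  have hev : (fun ζ : ℂ => g (ζ • w)) =ᶠ[𝓝 0] G := by
    filter_upwards [eventually_hasSum_taylorHomogeneous hU h0 hg w] with ζ hζ
    exact hζ.tsum_eq.symm
  have hO : IsOpen (ball (0 : ℂ) 1 ∩ V) := isOpen_ball.inter hVo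
  -- Convexity makes the intersection connected, so the identity theorem spreads the local expansion
  -- up to `ζ = 1`, which is then reached as a limit from the left.
  have hEq : Set.EqOn (fun ζ : ℂ => g (ζ • w)) G (ball 0 1 ∩ V) :=
    ((hhd.mono Set.inter_subset_right).analyticOnNhd hO).eqOn_of_preconnected_of_eventuallyEq
      ((hGd.mono Set.inter_subset_left).analyticOnNhd hO)
      ((convex_ball (0 : ℂ) 1).inter hVc).isPreconnected ⟨mem_ball_self one_pos, hV0⟩ hev
  have hseg : ∀ t : ℝ, t ∈ Set.Ico (0 : ℝ) 1 → (t : ℂ) ∈ ball (0 : ℂ) 1 ∩ V := by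
    intro t ht
    refine ⟨by simpa [abs_of_nonneg ht.1] using ht.2, ?_⟩
    have := hVc hV0 hV1 (sub_nonneg.2 ht.2.le) ht.1 (by ring)
    simpa using this
  have hlim1 : Tendsto (fun t : ℝ => G t) (𝓝[<] 1) (𝓝 (G 1)) := by
    have h1 := hGc 1 (by simp)
    refine h1.tendsto.comp (tendsto_nhdsWithin_iff.2 ⟨?_, ?_⟩)
    · have : Tendsto (fun t : ℝ => (t : ℂ)) (𝓝 1) (𝓝 1) := by
        simpa using Complex.continuous_ofReal.tendsto 1
      exact this.mono_left nhdsWithin_le_nhds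
    · filter_upwards [Ico_mem_nhdsLT (zero_lt_one (α := ℝ))] with t ht
      exact ball_subset_closedBall (hseg t ht).1
  have hlim2 : Tendsto (fun t : ℝ => g ((t : ℂ) • w)) (𝓝[<] 1) (𝓝 (g w)) := by
    have h1 := (hhd.continuousOn.continuousAt (hVo.mem_nhds hV1)).tendsto
    rw [one_smul] at h1
    refine h1.comp ?_
    have : Tendsto (fun t : ℝ => (t : ℂ)) (𝓝 1) (𝓝 1) := by
      simpa using Complex.continuous_ofReal.tendsto 1
    exact this.mono_left nhdsWithin_le_nhds
  have hG1 : G 1 = g w := by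
    refine tendsto_nhds_unique (hlim1.congr' ?_) hlim2
    filter_upwards [Ico_mem_nhdsLT (zero_lt_one (α := ℝ))] with t ht
    exact (hEq (hseg t ht)).symm
  have hfsum : Summable f := hsβ.of_norm
  have hval : ∑' β, f β = g w := by
    rw [← hG1, ← (hasSum_fiber_degree hfsum.hasSum).tsum_eq]
    exact tsum_congr fun d => by rw [one_pow, mul_one, hth]
  have h1 : HasSum f (g w) := hval ▸ hfsum.hasSum
  have h2 : HasSum (f ∘ enum) (g w) := enum.hasSum_iff.2 h1
  exact h2

end Expansion

/-! ### Convergence and termwise differentiation of the Lyapunov series. -/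

section LyapunovSeries

open Filter Metric Finset

variable {n : ℕ}

theorem norm_monomial_le {w : Fin n → ℂ} {ρ : ℝ} (hw : ∀ l, ‖w l‖ ≤ ρ) (α : Fin n → ℕ) :
    ‖monomial α w‖ ≤ ρ ^ degree α := by
  rw [monomial, norm_prod, degree, ← Finset.prod_pow_eq_pow_sum]
  refine Finset.prod_le_prod (fun l _ => norm_nonneg _) fun l _ => ?_
  rw [norm_pow]
  exact pow_le_pow_left₀ (norm_nonneg _) (hw l) _

theorem norm_fderiv_monomial_apply_le {w h : Fin n → ℂ} {ρ : ℝ} (hw : ∀ l, ‖w l‖ ≤ ρ)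
    (α : Fin n → ℕ) :
    ‖fderiv ℂ (monomial α) w h‖ ≤ degree α * ρ ^ (degree α - 1) * ‖h‖ := by
  rw [(hasFDerivAt_monomial α w).fderiv]
  simp only [_root_.sum_apply, smul_apply,
    ContinuousLinearMap.proj_apply, smul_eq_mul]
  calc _ ≤ ∑ l, ‖(α l : ℂ) * monomial (α - Pi.single l 1) w * h l‖ := norm_sum_le _ _
    _ ≤ ∑ l, (α l : ℝ) * ρ ^ (degree α - 1) * ‖h‖ := by
        refine Finset.sum_le_sum fun l _ => ?_
        by_cases hl : α l = 0
        · simp [hl]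
        · rw [norm_mul, norm_mul, Complex.norm_natCast]
          have h1 := norm_monomial_le hw (α - Pi.single l 1)
          rw [degree_sub_single hl] at h1
          have hρ : 0 ≤ ρ := (norm_nonneg _).trans (hw l)
          gcongr
          exact norm_le_pi_norm h l
    _ = _ := by
        rw [← Finset.sum_mul, ← Finset.sum_mul]
        simp [degree]

theorem hasFDerivAt_mulVec (B : Matrix (Fin n) (Fin n) ℂ) (z : Fin n → ℂ) :
    HasFDerivAt (fun z => B *ᵥ z) (LinearMap.toContinuousLinearMap B.mulVecLin) z :=
  (LinearMap.toContinuousLinearMap B.mulVecLin).hasFDerivAt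

variable [NeZero n]

/-- The `k`-th term of the Lyapunov series. -/
noncomputable def lyapunovTerm (B : Matrix (Fin n) (Fin n) ℂ) (ε : ℕ → ℝ) (k : ℕ)
    (z : Fin n → ℂ) : ℝ :=
  ε (k + 1) * ‖monomial (monomialEnum n (k + 1)) (B *ᵥ z)‖ ^ 2

variable {B : Matrix (Fin n) (Fin n) ℂ} {ε : ℕ → ℝ} {ρ : ℝ}

theorem hasFDerivAt_lyapunovTerm (k : ℕ) (z : Fin n → ℂ) :
    ∃ D : (Fin n → ℂ) →L[ℝ] ℝ, HasFDerivAt (lyapunovTerm B ε k) D z ∧ ∀ h, D h =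
      2 * (ε (k + 1) * ((starRingEnd ℂ) (monomial (monomialEnum n (k + 1)) (B *ᵥ z)) *
        fderiv ℂ (monomial (monomialEnum n (k + 1))) (B *ᵥ z) (B *ᵥ h)).re) := by
  have h1 := (differentiable_monomial (monomialEnum n (k + 1)) (B *ᵥ z)).hasFDerivAt.comp z
    (hasFDerivAt_mulVec B z)
  have h2 := ((h1.restrictScalars ℝ).norm_sq).const_mul (ε (k + 1))
  refine ⟨_, h2, fun h => ?_⟩
  simp [Complex.inner]
  ring

theorem contDiff_lyapunovTerm (k : ℕ) : ContDiff ℝ 1 (lyapunovTerm B ε k) := by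
  unfold lyapunovTerm monomial
  refine ContDiff.mul contDiff_const (ContDiff.norm_sq ℝ (contDiff_prod fun l _ => ?_))
  refine ContDiff.pow ?_ _
  have : ContDiff ℝ 1 fun z : Fin n → ℂ => B *ᵥ z :=
    ((LinearMap.toContinuousLinearMap B.mulVecLin).restrictScalars ℝ).contDiff
  exact contDiff_pi.1 this l

/-- Differentiating `|w^α|²` costs a factor `2 |α|` and one power of `ρ`, hence `2 / ρ`. The bound
is uniform on the ball and is a constant times the term of the series assumed to converge. -/
theorem norm_fderiv_lyapunovTerm_le (hρ : 0 < ρ) (hε : ∀ j, 1 ≤ j → 0 < ε j)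
    (hB : ∀ z, ‖B *ᵥ z‖ ≤ ‖z‖) (k : ℕ) {z : Fin n → ℂ} (hz : z ∈ ball 0 ρ) :
    ‖fderiv ℝ (lyapunovTerm B ε k) z‖ ≤ 2 / ρ * ((degree (monomialEnum n (k + 1)) : ℝ) * ε (k + 1)
        * ρ ^ (2 * degree (monomialEnum n (k + 1)))) := by
  obtain ⟨D, hD, hDh⟩ := hasFDerivAt_lyapunovTerm (B := B) (ε := ε) k z
  rw [hD.fderiv]
  set α := monomialEnum n (k + 1) with hα
  have hd : degree α ≠ 0 := degree_monomialEnum_ne_zero (by omega)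
  have hεk := hε (k + 1) (by omega)
  have hw : ∀ l, ‖(B *ᵥ z) l‖ ≤ ρ := fun l =>
    (norm_le_pi_norm _ l).trans ((hB z).trans (mem_ball_zero_iff.1 hz).le)
  refine D.opNorm_le_bound (by positivity) fun h => ?_
  rw [hDh, Real.norm_eq_abs, abs_mul, abs_mul, abs_two, abs_of_pos hεk]
  have h1 := Complex.abs_re_le_norm ((starRingEnd ℂ) (monomial α (B *ᵥ z)) *
        fderiv ℂ (monomial α) (B *ᵥ z) (B *ᵥ h))
  rw [norm_mul, Complex.norm_conj] at h1
  have h2 := norm_monomial_le hw α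
  have h3 := norm_fderiv_monomial_apply_le (h := B *ᵥ h) hw α
  have hpow : ρ ^ (2 * degree α) = ρ ^ degree α * (ρ ^ (degree α - 1) * ρ) := by
    rw [← pow_succ, Nat.sub_add_cancel (Nat.one_le_iff_ne_zero.2 hd)]
    ring
  calc _ ≤ 2 * (ε (k + 1) * (ρ ^ degree α * (degree α * ρ ^ (degree α - 1) * ‖h‖))) := by
        have h4 := hB h
        have h5 : ‖fderiv ℂ (monomial α) (B *ᵥ z) (B *ᵥ h)‖
          ≤ degree α * ρ ^ (degree α - 1) * ‖h‖ := h3.trans (by gcongr)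
        have h6 : ‖monomial α (B *ᵥ z)‖ * ‖fderiv ℂ (monomial α) (B *ᵥ z) (B *ᵥ h)‖
          ≤ ρ ^ degree α * (degree α * ρ ^ (degree α - 1) * ‖h‖) := by gcongr
        gcongr
        exact h1.trans h6
    _ = _ := by
        rw [hpow]
        field_simp

theorem lyapunovTerm_nonneg (hε : ∀ j, 1 ≤ j → 0 < ε j) (k : ℕ) (z : Fin n → ℂ) :
    0 ≤ lyapunovTerm B ε k z := by
  have := hε (k + 1) (by omega)
  unfold lyapunovTerm
  positivity

/-- Since `|α| ≥ 1`, the majorant used for the derivatives also serves for the terms. -/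
theorem lyapunovTerm_le (hε : ∀ j, 1 ≤ j → 0 < ε j) (hB : ∀ z, ‖B *ᵥ z‖ ≤ ‖z‖) (k : ℕ)
    {z : Fin n → ℂ} (hz : z ∈ ball 0 ρ) :
    lyapunovTerm B ε k z ≤ (degree (monomialEnum n (k + 1)) : ℝ) * ε (k + 1)
        * ρ ^ (2 * degree (monomialEnum n (k + 1))) := by
  have hεk := hε (k + 1) (by omega)
  have hd : degree (monomialEnum n (k + 1)) ≠ 0 := degree_monomialEnum_ne_zero (by omega)
  have hw : ∀ l, ‖(B *ᵥ z) l‖ ≤ ρ := fun l =>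
    (norm_le_pi_norm _ l).trans ((hB z).trans (mem_ball_zero_iff.1 hz).le)
  have h2 := pow_le_pow_left₀ (norm_nonneg _) (norm_monomial_le hw (monomialEnum n (k + 1))) 2
  have h1 : (1 : ℝ) ≤ degree (monomialEnum n (k + 1)) := by
    exact_mod_cast Nat.one_le_iff_ne_zero.2 hd
  rw [← pow_mul, mul_comm _ 2] at h2
  unfold lyapunovTerm
  have h3 : 0 ≤ ρ ^ (2 * degree (monomialEnum n (k + 1))) := (sq_nonneg _).trans h2
  calc _ ≤ ε (k + 1) * ρ ^ (2 * degree (monomialEnum n (k + 1))) := by gcongr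
    _ ≤ _ := by
      have : 0 ≤ ε (k + 1) * ρ ^ (2 * degree (monomialEnum n (k + 1))) := by positivity
      nlinarith

theorem summable_lyapunovTerm (hε : ∀ j, 1 ≤ j → 0 < ε j) (hB : ∀ z, ‖B *ᵥ z‖ ≤ ‖z‖)
    (hs : Summable fun k : ℕ => (degree (monomialEnum n (k + 1)) : ℝ) * ε (k + 1)
        * ρ ^ (2 * degree (monomialEnum n (k + 1)))) {z : Fin n → ℂ} (hz : z ∈ ball 0 ρ) :
    Summable fun k => lyapunovTerm B ε k z :=
  Summable.of_nonneg_of_le (fun k => lyapunovTerm_nonneg hε k z)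
    (fun k => lyapunovTerm_le hε hB k hz) hs

theorem hasFDerivAt_tsum_lyapunovTerm (hρ : 0 < ρ) (hε : ∀ j, 1 ≤ j → 0 < ε j)
    (hB : ∀ z, ‖B *ᵥ z‖ ≤ ‖z‖)
    (hs : Summable fun k : ℕ => (degree (monomialEnum n (k + 1)) : ℝ) * ε (k + 1)
        * ρ ^ (2 * degree (monomialEnum n (k + 1)))) {z : Fin n → ℂ} (hz : z ∈ ball 0 ρ) :
    HasFDerivAt (fun z => ∑' k, lyapunovTerm B ε k z)
      (∑' k, fderiv ℝ (lyapunovTerm B ε k) z) z :=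
  hasFDerivAt_tsum_of_isPreconnected (hs.mul_left (2 / ρ)) isOpen_ball
    (convex_ball _ _).isPreconnected
    (fun k z _ => ((contDiff_lyapunovTerm k).differentiable one_ne_zero z).hasFDerivAt)
    (fun k _ hz => norm_fderiv_lyapunovTerm_le hρ hε hB k hz) (mem_ball_self hρ)
    (summable_lyapunovTerm hε hB hs (mem_ball_self hρ)) hz

theorem contDiffOn_tsum_lyapunovTerm (hρ : 0 < ρ) (hε : ∀ j, 1 ≤ j → 0 < ε j)
    (hB : ∀ z, ‖B *ᵥ z‖ ≤ ‖z‖)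
    (hs : Summable fun k : ℕ => (degree (monomialEnum n (k + 1)) : ℝ) * ε (k + 1)
        * ρ ^ (2 * degree (monomialEnum n (k + 1)))) :
    ContDiffOn ℝ 1 (fun z => ∑' k, lyapunovTerm B ε k z) (ball 0 ρ) := by
  rw [← zero_add (1 : WithTop ℕ∞), contDiffOn_succ_iff_fderiv_of_isOpen isOpen_ball]
  refine ⟨fun z hz => (hasFDerivAt_tsum_lyapunovTerm hρ hε hB hs hz).differentiableAt
    |>.differentiableWithinAt, by simp, ?_⟩
  rw [contDiffOn_zero]
  refine ContinuousOn.congr (f := fun z => ∑' k, fderiv ℝ (lyapunovTerm B ε k) z) ?_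
    fun z hz => (hasFDerivAt_tsum_lyapunovTerm hρ hε hB hs hz).fderiv
  exact continuousOn_tsum
    (fun k => ((contDiff_lyapunovTerm k).continuous_fderiv one_ne_zero).continuousOn)
    (hs.mul_left (2 / ρ)) fun k z hz => norm_fderiv_lyapunovTerm_le hρ hε hB k hz

theorem fderiv_tsum_lyapunovTerm_apply (hρ : 0 < ρ) (hε : ∀ j, 1 ≤ j → 0 < ε j)
    (hB : ∀ z, ‖B *ᵥ z‖ ≤ ‖z‖)
    (hs : Summable fun k : ℕ => (degree (monomialEnum n (k + 1)) : ℝ) * ε (k + 1)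
        * ρ ^ (2 * degree (monomialEnum n (k + 1)))) {z : Fin n → ℂ} (hz : z ∈ ball 0 ρ)
    (h : Fin n → ℂ) :
    fderiv ℝ (fun z => ∑' k, lyapunovTerm B ε k z) z h = ∑' k,
      2 * (ε (k + 1) * ((starRingEnd ℂ) (monomial (monomialEnum n (k + 1)) (B *ᵥ z)) *
        fderiv ℂ (monomial (monomialEnum n (k + 1))) (B *ᵥ z) (B *ᵥ h)).re) := by
  rw [(hasFDerivAt_tsum_lyapunovTerm hρ hε hB hs hz).fderiv]
  have hsum : Summable fun k => fderiv ℝ (lyapunovTerm B ε k) z :=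
    Summable.of_norm_bounded (hs.mul_left (2 / ρ))
      fun k => norm_fderiv_lyapunovTerm_le hρ hε hB k hz
  rw [show (∑' k, fderiv ℝ (lyapunovTerm B ε k) z) h = ∑' k, fderiv ℝ (lyapunovTerm B ε k) z h from
    (ContinuousLinearMap.apply ℝ ℝ h).map_tsum hsum]
  refine tsum_congr fun k => ?_
  obtain ⟨D, hD, hDh⟩ := hasFDerivAt_lyapunovTerm (B := B) (ε := ε) k z
  rw [hD.fderiv, hDh]

end LyapunovSeries

/-! ### The vector field in triangularizing coordinates. -/

section ConjugateField

open Filter Metric Finset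

variable {n : ℕ} {P : Matrix (Fin n) (Fin n) ℂ} {F : (Fin n → ℂ) → (Fin n → ℂ)}

theorem convex_polydisk (ρ : ℝ) : Convex ℝ (polydisk n ρ) := by
  have : polydisk n ρ = ⋂ l, (fun z : Fin n → ℂ => z l) ⁻¹' ball (0 : ℂ) ρ := by
    ext; simp [polydisk]
  rw [this]
  exact convex_iInter fun l =>
    (convex_ball (0 : ℂ) ρ).linear_preimage (LinearMap.proj (R := ℝ) (φ := fun _ : Fin n => ℂ) l)

/-- The polydisk in the coordinates `w = P⁻¹ z`. -/
def conjPolydisk (P : Matrix (Fin n) (Fin n) ℂ) : Set (Fin n → ℂ) := {w | P *ᵥ w ∈ polydisk n 1}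

theorem continuous_mulVec (B : Matrix (Fin n) (Fin n) ℂ) : Continuous fun z => B *ᵥ z :=
  (LinearMap.toContinuousLinearMap B.mulVecLin).continuous

theorem isOpen_conjPolydisk (P : Matrix (Fin n) (Fin n) ℂ) : IsOpen (conjPolydisk P) :=
  (isOpen_polydisk 1).preimage (continuous_mulVec P)

theorem convex_conjPolydisk (P : Matrix (Fin n) (Fin n) ℂ) : Convex ℝ (conjPolydisk P) :=
  (convex_polydisk 1).linear_preimage (P.mulVecLin.restrictScalars ℝ)

theorem zero_mem_conjPolydisk (P : Matrix (Fin n) (Fin n) ℂ) : 0 ∈ conjPolydisk P := by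
  simp [conjPolydisk, polydisk]

theorem hasFDerivAt_conjField {w : Fin n → ℂ} (hF : DifferentiableAt ℂ F (P *ᵥ w)) :
    HasFDerivAt (conjField P F) ((LinearMap.toContinuousLinearMap P⁻¹.mulVecLin).comp
      ((fderiv ℂ F (P *ᵥ w)).comp (LinearMap.toContinuousLinearMap P.mulVecLin))) w :=
  (hasFDerivAt_mulVec P⁻¹ (F (P *ᵥ w))).comp w (hF.hasFDerivAt.comp w (hasFDerivAt_mulVec P w))

theorem differentiableOn_conjField (hF : DifferentiableOn ℂ F (polydisk n 1)) :
    DifferentiableOn ℂ (conjField P F) (conjPolydisk P) := fun _ hw =>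
  (hasFDerivAt_conjField (hF.differentiableAt
    ((isOpen_polydisk 1).mem_nhds hw))).differentiableAt.differentiableWithinAt

theorem conjField_zero (hF0 : F 0 = 0) : conjField P F 0 = 0 := by
  simp [conjField, hF0]

theorem jacobian_conjField_zero (hF : DifferentiableOn ℂ F (polydisk n 1)) :
    jacobian (conjField P F) 0 = P⁻¹ * jacobian F 0 * P := by
  have h0 : (0 : Fin n → ℂ) ∈ polydisk n 1 := by simp [polydisk]
  have hd : DifferentiableAt ℂ F (P *ᵥ 0) := by
    rw [Matrix.mulVec_zero]
    exact hF.differentiableAt ((isOpen_polydisk 1).mem_nhds h0)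
  rw [jacobian, (hasFDerivAt_conjField hd).fderiv, Matrix.mulVec_zero]
  have : ((((LinearMap.toContinuousLinearMap P⁻¹.mulVecLin).comp
      ((fderiv ℂ F 0).comp (LinearMap.toContinuousLinearMap P.mulVecLin))) :
        (Fin n → ℂ) →L[ℂ] (Fin n → ℂ)) : (Fin n → ℂ) →ₗ[ℂ] (Fin n → ℂ))
      = Matrix.toLin' P⁻¹ ∘ₗ ((fderiv ℂ F 0 : (Fin n → ℂ) →ₗ[ℂ] (Fin n → ℂ)) ∘ₗ Matrix.toLin' P) := by
    ext; rfl
  rw [this, LinearMap.toMatrix'_comp, LinearMap.toMatrix'_comp, LinearMap.toMatrix'_toLin',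
    LinearMap.toMatrix'_toLin', jacobian, mul_assoc]

/-- Subtracting `T` from the scalar matrix `T l l` leaves a triangular matrix with a zero on its
diagonal, hence with determinant `0`. -/
theorem diag_mem_spectrum {T : Matrix (Fin n) (Fin n) ℂ} (hT : T.BlockTriangular id) (l : Fin n) :
    T l l ∈ spectrum ℂ T := by
  rw [spectrum.mem_iff, Matrix.isUnit_iff_isUnit_det, isUnit_iff_ne_zero, not_not]
  have h : (algebraMap ℂ (Matrix (Fin n) (Fin n) ℂ) (T l l) - T).BlockTriangular id := by
    refine Matrix.BlockTriangular.sub ?_ hT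
    rw [Matrix.algebraMap_eq_diagonal]
    exact Matrix.blockTriangular_diagonal _
  rw [Matrix.det_of_isUpperTriangular h]
  refine Finset.prod_eq_zero (Finset.mem_univ l) ?_
  simp [Matrix.algebraMap_matrix_apply]

theorem re_diag_conj_neg {J : Matrix (Fin n) (Fin n) ℂ} (hJ : ∀ μ ∈ spectrum ℂ J, μ.re < 0)
    (hP : IsUnit P) (hT : (P⁻¹ * J * P).BlockTriangular id) (l : Fin n) :
    ((P⁻¹ * J * P) l l).re < 0 := by
  refine hJ _ ?_
  have h := diag_mem_spectrum hT l
  obtain ⟨u, rfl⟩ := hP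
  rw [← Matrix.coe_units_inv] at h ⊢
  rwa [spectrum.units_conjugate'] at h

theorem norm_mulVec_le {B : Matrix (Fin n) (Fin n) ℂ} (hB : infNorm B = 1) (z : Fin n → ℂ) :
    ‖B *ᵥ z‖ ≤ ‖z‖ := by
  open scoped Matrix.Norms.Operator in
  have h := Matrix.linfty_opNorm_mulVec B z
  have h1 : ‖B‖ = 1 := hB
  rwa [h1, one_mul] at h

theorem monomial_zero_apply {α : Fin n → ℕ} (hα : degree α ≠ 0) : monomial α 0 = 0 := by
  obtain ⟨l, hl, hl'⟩ := Finset.exists_ne_zero_of_sum_ne_zero hα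
  exact Finset.prod_eq_zero hl (zero_pow hl')

variable [NeZero n]

/-- The linear growth in the degree is what the factor `|α(k)|` in the convergence hypothesis
absorbs. -/
theorem norm_koopmanEntry_diag_le {U : Set (Fin n → ℂ)} (hU : IsOpen U) (h0 : 0 ∈ U)
    (hF : DifferentiableOn ℂ F U) (hF0 : F 0 = 0) {k : ℕ} (hk : 1 ≤ k) :
    ‖koopmanEntry F k k‖ ≤ (∑ l, ‖jacobian F 0 l l‖) * degree (monomialEnum n k) := by
  rw [koopmanEntry_diag hU h0 hF hF0 hk, Finset.sum_mul]
  refine (norm_sum_le _ _).trans (Finset.sum_le_sum fun l _ => ?_)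
  rw [norm_mul, Complex.norm_natCast, mul_comm]
  have : monomialEnum n k l ≤ degree (monomialEnum n k) :=
    Finset.single_le_sum (fun _ _ => Nat.zero_le _) (Finset.mem_univ l)
  gcongr

theorem re_koopmanEntry_diag_neg {U : Set (Fin n → ℂ)} (hU : IsOpen U) (h0 : 0 ∈ U)
    (hF : DifferentiableOn ℂ F U) (hF0 : F 0 = 0) (hJ : ∀ l, (jacobian F 0 l l).re < 0) {k : ℕ}
    (hk : 1 ≤ k) : (koopmanEntry F k k).re < 0 := by
  rw [koopmanEntry_diag hU h0 hF hF0 hk, Complex.re_sum]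
  have hre : ∀ l, ((monomialEnum n k l : ℂ) * jacobian F 0 l l).re
      = monomialEnum n k l * (jacobian F 0 l l).re := fun l => by
    rw [← Complex.ofReal_natCast, Complex.re_ofReal_mul]
  simp only [hre]
  obtain ⟨l, hl⟩ : ∃ l, monomialEnum n k l ≠ 0 := by
    by_contra! h
    exact degree_monomialEnum_ne_zero hk (Finset.sum_eq_zero fun l _ => h l)
  refine Finset.sum_neg' (fun i _ => mul_nonpos_of_nonneg_of_nonpos (Nat.cast_nonneg _) (hJ i).le)
    ⟨l, Finset.mem_univ l, mul_neg_of_pos_of_neg ?_ (hJ l)⟩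
  exact_mod_cast Nat.pos_of_ne_zero hl

/-- A nonzero coordinate of `w` is itself a monomial of positive index. This yields positivity of
`V` and strictness of its decrease. -/
theorem exists_monomial_ne_zero {w : Fin n → ℂ} (hw : w ≠ 0) :
    ∃ k, monomial (monomialEnum n (k + 1)) w ≠ 0 := by
  obtain ⟨l, hl⟩ := Function.ne_iff.1 hw
  obtain ⟨j, hj⟩ := (monomialEnum_bijective n).2 (Pi.single l 1)
  have hj0 : j ≠ 0 := by
    rintro rfl
    rw [monomialEnum_zero] at hj
    have := congrFun hj l
    simp at this
  obtain ⟨k, rfl⟩ := Nat.exists_eq_succ_of_ne_zero hj0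
  refine ⟨k, ?_⟩
  rw [Nat.succ_eq_add_one] at hj
  rw [hj, monomial, Finset.prod_ne_zero_iff]
  intro i _
  by_cases hi : i = l
  · subst hi; simpa using hl
  · simp [hi]

end ConjugateField

/-! ### Decrease of the Lyapunov series along each vector field. -/

section LyapunovDerivative

open Filter Metric

variable {n : ℕ} [NeZero n] {P : Matrix (Fin n) (Fin n) ℂ} {F : (Fin n → ℂ) → (Fin n → ℂ)}
  {b : ℕ → ℕ → ℝ} {ε : ℕ → ℝ} {ρ : ℝ}

/-- All indices are shifted by one, which discards the constant monomial `α(0) = 0`. -/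
theorem isDominated_koopmanEntry (hF : DifferentiableOn ℂ F (polydisk n 1)) (hF0 : F 0 = 0)
    (hJ : ∀ μ ∈ spectrum ℂ (jacobian F 0), μ.re < 0) (hP : IsUnit P)
    (hT : (P⁻¹ * jacobian F 0 * P).BlockTriangular id)
    (hb0 : ∀ j k, 1 ≤ j → 1 ≤ k → 0 ≤ b j k)
    (hb : ∀ j k, 1 ≤ j → 1 ≤ k → koopmanEntry (conjField P F) k j ≠ 0 → 0 < b j k * b k j)
    (hbs : ∀ j, 1 ≤ j → Summable (fun k : ℕ => b j (k + 1)) ∧ ∑' k : ℕ, b j (k + 1) ≤ 1)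
    (hε : ∀ j, 1 ≤ j → 0 < ε j)
    (hεQ : ∀ j k, 1 ≤ k → k < j → ε k * crossRatio (conjField P F) b j k < ε j) :
    IsDominated (fun k => ε (k + 1)) (fun k j => koopmanEntry (conjField P F) (k + 1) (j + 1))
      (fun j k => b (j + 1) (k + 1)) := by
  have hU := isOpen_conjPolydisk P
  have h0 := zero_mem_conjPolydisk P
  have hFd := differentiableOn_conjField (P := P) hF
  have hF0' : conjField P F 0 = 0 := conjField_zero hF0
  have hjac := jacobian_conjField_zero (P := P) hF
  refine ⟨fun j => hε _ (by omega), fun k j hjk => ?_, fun k => ?_,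
    fun j k => hb0 _ _ (by omega) (by omega), fun j k => hb _ _ (by omega) (by omega),
    fun j => (hbs _ (by omega)).1, fun j => (hbs _ (by omega)).2, fun k j hkj hne => ?_⟩
  · exact koopmanEntry_eq_zero hU h0 hFd hF0' (by rwa [hjac]) (by omega)
  · refine re_koopmanEntry_diag_neg hU h0 hFd hF0' (fun l => ?_) (by omega)
    rw [hjac]
    exact re_diag_conj_neg hJ hP hT l
  · have := hεQ (j + 1) (k + 1) (by omega) (by omega)
    rwa [crossRatio, if_pos hne] at this

/-- The derivative of the Lyapunov series along the vector field is negative. -/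
theorem fderiv_tsum_lyapunovTerm_neg (hρ0 : 0 < ρ) (hρ1 : ρ ≤ 1)
    (hF : DifferentiableOn ℂ F (polydisk n 1)) (hF0 : F 0 = 0) (hP : IsUnit P)
    (hPn : infNorm P⁻¹ = 1)
    (hT : (P⁻¹ * jacobian F 0 * P).BlockTriangular id)
    (hdom : IsDominated (fun k => ε (k + 1))
      (fun k j => koopmanEntry (conjField P F) (k + 1) (j + 1)) (fun j k => b (j + 1) (k + 1)))
    (hε : ∀ j, 1 ≤ j → 0 < ε j)
    (hs : Summable (fun k : ℕ => (degree (monomialEnum n (k + 1)) : ℝ) * ε (k + 1)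
        * ρ ^ (2 * degree (monomialEnum n (k + 1)))))
    {z : Fin n → ℂ} (hz : z ∈ ball 0 ρ) (hz0 : z ≠ 0) :
    fderiv ℝ (fun z => ∑' k, lyapunovTerm P⁻¹ ε k z) z (F z) < 0 := by
  have hU := isOpen_conjPolydisk P
  have h0 := zero_mem_conjPolydisk P
  have hFd := differentiableOn_conjField (P := P) hF
  have hF0' : conjField P F 0 = 0 := conjField_zero hF0
  have hjac := jacobian_conjField_zero (P := P) hF
  have hdet : IsUnit P.det := (Matrix.isUnit_iff_isUnit_det P).1 hP
  have hB := norm_mulVec_le hPn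
  set w := P⁻¹ *ᵥ z with hw
  have hPw : P *ᵥ w = z := by
    rw [hw, Matrix.mulVec_mulVec, Matrix.mul_nonsing_inv P hdet, Matrix.one_mulVec]
  have hw0 : w ≠ 0 := by
    intro h
    rw [h, Matrix.mulVec_zero] at hPw
    exact hz0 hPw.symm
  have hwU : w ∈ conjPolydisk P := by
    change P *ᵥ w ∈ polydisk n 1
    rw [hPw, polydisk_eq_ball one_pos]
    exact ball_subset_ball hρ1 hz
  set v : ℕ → ℂ := fun k => monomial (monomialEnum n (k + 1)) w with hv
  set A : ℕ → ℕ → ℂ := fun k j => koopmanEntry (conjField P F) (k + 1) (j + 1) with hA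
  set Λ := ∑ l, ‖jacobian (conjField P F) 0 l l‖ with hΛ
  have hsA : Summable fun j => ‖A j j‖ * (ε (j + 1) * ‖v j‖ ^ 2) := by
    refine Summable.of_nonneg_of_le (fun j => ?_) (fun j => ?_) (hs.mul_left Λ)
    · have := hε (j + 1) (by omega)
      positivity
    · have h1 := norm_koopmanEntry_diag_le hU h0 hFd hF0' (k := j + 1) (by omega)
      have h2 : ‖v j‖ ^ 2 ≤ ρ ^ (2 * degree (monomialEnum n (j + 1))) := by
        have := norm_monomial_le (w := w) (ρ := ρ) (fun l =>
          (norm_le_pi_norm _ l).trans ((hB z).trans (mem_ball_zero_iff.1 hz).le))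
          (monomialEnum n (j + 1))
        have := pow_le_pow_left₀ (norm_nonneg _) this 2
        rwa [← pow_mul, mul_comm _ 2] at this
      have h3 := hε (j + 1) (by omega)
      calc ‖A j j‖ * (ε (j + 1) * ‖v j‖ ^ 2)
          ≤ (Λ * degree (monomialEnum n (j + 1))) *
            (ε (j + 1) * ρ ^ (2 * degree (monomialEnum n (j + 1)))) := by gcongr
        _ = _ := by ring
  have hprod := hdom.summable_prod (v := v) hsA
  -- Absolute convergence of row `k` comes from the double series after division by `ε_k |v_k|`. If
  -- `v k = 0`, the row enters the derivative with factor `0` and its expansion is not needed.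
  have hterm : ∀ k, v k ≠ 0 → HasSum (fun j => A k j * v j)
      (koopmanGenerator (conjField P F) (monomial (monomialEnum n (k + 1))) w) := by
    intro k hk
    have hc : 0 < ε (k + 1) * ‖v k‖ := mul_pos (hε _ (by omega)) (norm_pos_iff.2 hk)
    have h1 : Summable fun j => ‖A k j * v j‖ := by
      have h2 := (hprod.prod_factor k).mul_left (ε (k + 1) * ‖v k‖)⁻¹
      refine h2.congr fun j => ?_
      have h3 := (hε (k + 1) (by omega)).ne'
      have h4 := norm_ne_zero_iff.2 hk
      rw [norm_mul]
      field_simp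
    -- The constant Taylor coefficient vanishes, so the expansion may start at index `1`.
    have hzero : koopmanEntry (conjField P F) (k + 1) 0 = 0 :=
      koopmanEntry_eq_zero hU h0 hFd hF0' (by rwa [hjac]) (by omega)
    have hcoef : ∀ j, taylorCoeff (koopmanGenerator (conjField P F)
        (monomial (monomialEnum n (k + 1)))) (monomialEnum n j)
          = koopmanEntry (conjField P F) (k + 1) j :=
      fun j => (koopmanEntry_eq_taylorCoeff _ _ _).symm
    have h3 : Summable fun j =>
        ‖taylorCoeff (koopmanGenerator (conjField P F) (monomial (monomialEnum n (k + 1))))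
          (monomialEnum n j) * monomial (monomialEnum n j) w‖ := by
      rw [← summable_nat_add_iff 1]
      simp only [hcoef]
      exact h1
    have h4 := hasSum_taylorCoeff hU (convex_conjPolydisk P) h0
      (differentiableOn_koopmanGenerator hFd _) hwU h3
    rw [← hasSum_nat_add_iff' 1] at h4
    simp only [hcoef, Finset.sum_range_one, hzero, zero_mul, sub_zero] at h4
    exact h4
  rw [fderiv_tsum_lyapunovTerm_apply hρ0 hε hB hs hz]
  have hneg := hdom.tsum_neg hsA (exists_monomial_ne_zero hw0)
  have hT' : Summable fun p : ℕ × ℕ =>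
      2 * (ε (p.1 + 1) * ((starRingEnd ℂ) (v p.1) * (A p.1 p.2 * v p.2)).re) := by
    refine Summable.of_norm_bounded (hprod.mul_left 2) fun p => ?_
    have h1 := hε (p.1 + 1) (by omega)
    rw [Real.norm_eq_abs, abs_mul, abs_mul, abs_of_pos h1, abs_two]
    have := abs_re_conj_mul_mul_le (v p.1) (A p.1 p.2) (v p.2)
    gcongr
  rw [hT'.tsum_prod] at hneg
  refine lt_of_eq_of_lt (tsum_congr fun k => ?_) hneg
  have hgen : fderiv ℂ (monomial (monomialEnum n (k + 1))) w (P⁻¹ *ᵥ F z)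
      = koopmanGenerator (conjField P F) (monomial (monomialEnum n (k + 1))) w := by
    rw [koopmanGenerator, conjField, hPw]
  rw [hgen]
  change 2 * (ε (k + 1) * ((starRingEnd ℂ) (v k) * _).re) = ∑' j,
    2 * (ε (k + 1) * ((starRingEnd ℂ) (v k) * (A k j * v j)).re)
  by_cases hk : v k = 0
  · simp [hk]
  · have h1 := (Complex.reCLM.hasSum ((hterm k hk).mul_left ((starRingEnd ℂ) (v k)))).mul_left
      (ε (k + 1))
    exact (h1.mul_left 2).tsum_eq.symm

end LyapunovDerivative

/-! ### Monotonicity from one-sided information off a finite set. -/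

section Monotonicity

open Filter Set

/-- A continuous function that does not increase just to the right of every point, apart from
finitely many points, does not increase. -/
theorem image_right_le_of_eventually_le {u : ℝ → ℝ} {c : ℝ} {S : Set ℝ} (hS : S.Finite) :
    ∀ {a b : ℝ}, a ≤ b → ContinuousOn u (Icc a b) →
      (∀ t ∈ Ioo a b, t ∉ S → u t < c → ∀ᶠ s in 𝓝[>] t, u s ≤ u t) → u a < c → u b ≤ u a := by
  induction S, hS using Set.Finite.induction_on with
  | empty =>
    intro a b hab hu h ha
    rcases hab.eq_or_lt with rfl | hab
    · exact le_rfl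
    have hcont : Tendsto u (𝓝[>] a) (𝓝 (u a)) :=
      ((hu a (left_mem_Icc.2 hab.le)).mono_of_mem_nhdsWithin (Icc_mem_nhdsGT hab)).tendsto
    -- Nothing is assumed at `a` itself, so the argument starts at `a' > a` and lets `a'` tend to
    -- `a`.
    refine ge_of_tendsto hcont ?_
    filter_upwards [Ioo_mem_nhdsGT hab, hcont.eventually (gt_mem_nhds ha)] with a' ha' hlt
    have hclosed : IsClosed ({t | u t ≤ u a'} ∩ Icc a' b) := by
      rw [inter_comm]
      exact (hu.mono (Icc_subset_Icc_left ha'.1.le)).preimage_isClosed_of_isClosed isClosed_Icc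
        isClosed_Iic
    refine hclosed.Icc_subset_of_forall_exists_gt (mem_ofPred.2 le_rfl) (fun t ht y hy => ?_)
      (right_mem_Icc.2 ha'.2.le)
    have ht1 : u t ≤ u a' := ht.1
    have hev := h t ⟨ha'.1.trans_le ht.2.1, ht.2.2⟩ (notMem_empty t) (ht1.trans_lt hlt)
    obtain ⟨s, hs, hs'⟩ := (hev.and (Ioc_mem_nhdsGT hy)).exists
    exact ⟨s, hs.trans ht1, hs'⟩
  | insert _ _ ih =>
    rename_i p S _ _
    intro a b hab hu h ha
    by_cases hp : p ∈ Ioo a b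
    · have h1 := ih hp.1.le (hu.mono (Icc_subset_Icc_right hp.2.le)) (fun t ht htS =>
        h t ⟨ht.1, ht.2.trans hp.2⟩ (by simp [htS, ht.2.ne])) ha
      exact (ih hp.2.le (hu.mono (Icc_subset_Icc_left hp.1.le)) (fun t ht htS =>
        h t ⟨hp.1.trans ht.1, ht.2⟩ (by simp [htS, ht.1.ne'])) (h1.trans_lt ha)).trans h1
    · refine ih hab hu (fun t ht htS => h t ht ?_) ha
      rintro (rfl | h2)
      · exact hp ht
      · exact htS h2

theorem eventually_le_of_hasDerivWithinAt_neg {u : ℝ → ℝ} {d t : ℝ}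
    (h : HasDerivWithinAt u d (Ici t) t) (hd : d < 0) : ∀ᶠ s in 𝓝[>] t, u s ≤ u t := by
  have h1 := (hasDerivWithinAt_iff_tendsto_slope' (notMem_Ioi.2 le_rfl)).1
    (h.mono Ioi_subset_Ici_self)
  filter_upwards [h1.eventually (gt_mem_nhds hd), self_mem_nhdsWithin] with s hs hts
  have hts : 0 < s - t := sub_pos.2 hts
  rw [slope_def_field, div_lt_iff₀ hts, zero_mul] at hs
  linarith

end Monotonicity

/-! ### Stability of switched trajectories. -/

section SwitchedTrajectory

open Filter Set Metric

variable {n m : ℕ} {X : Set (Fin n → ℂ)} {F : Fin m → (Fin n → ℂ) → (Fin n → ℂ)} {σ : ℝ → Fin m}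
  {x : ℝ → (Fin n → ℂ)}

/-- A property of the trajectory that does not increase away from the switching times does not
increase at all. -/
theorem IsCommutationLaw.le_of_eventually_le (hσ : IsCommutationLaw σ) {u : ℝ → ℝ} {c a b : ℝ}
    (ha : 0 ≤ a) (hab : a ≤ b) (hu : ContinuousOn u (Icc a b))
    (h : ∀ t ∈ Ioo a b, ContinuousWithinAt σ (Ici 0) t → u t < c → ∀ᶠ s in 𝓝[>] t, u s ≤ u t)
    (hc : u a < c) : u b ≤ u a :=
  image_right_le_of_eventually_le (hσ b) hab hu (fun t ht htS => h t ht (by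
    by_contra hcon
    exact htS ⟨ha.trans ht.1.le, ht.2.le, hcon⟩)) hc

/-- Between two switching times, a trajectory solves one of the equations. -/
theorem IsSwitchedTrajectory.exists_isSolution (hx : IsSwitchedTrajectory X F σ x) {t : ℝ}
    (ht : 0 ≤ t) (hσ : ContinuousWithinAt σ (Ici 0) t) :
    ∃ T > 0, IsSolution (F (σ t)) T fun s => x (t + s) := by
  -- The values of `σ` lie in a discrete space, so continuity means local constancy.
  have h1 : ∀ᶠ s in 𝓝[Ici 0] t, σ s = σ t := by
    have h := hσ.tendsto
    rw [nhds_discrete] at h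
    exact h.eventually (p := fun i => i = σ t) rfl
  obtain ⟨δ, hδ, h2⟩ := Metric.mem_nhdsWithin_iff.1 h1
  refine ⟨δ, hδ, ?_, fun s hs => ?_⟩
  · exact hx.continuousOn.comp (by fun_prop) fun s hs => add_nonneg ht hs.1
  · have hs0 : 0 ≤ t + s := add_nonneg ht hs.1
    have hmem : t + s ∈ ball t δ := by
      rw [mem_ball, Real.dist_eq, add_sub_cancel_left, abs_of_nonneg hs.1]
      exact hs.2
    have hval : σ (t + s) = σ t := h2 ⟨hmem, hs0⟩
    have hcont : ContinuousWithinAt σ (Ici 0) (t + s) := by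
      refine ContinuousWithinAt.congr_of_eventuallyEq (f := fun _ => σ t)
        continuousWithinAt_const ?_ hval
      filter_upwards [mem_nhdsWithin_of_mem_nhds (isOpen_ball.mem_nhds hmem),
        self_mem_nhdsWithin] with r hr hr0
      exact h2 ⟨hr, hr0⟩
    have h3 := (hx.deriv _ hs0 hcont).scomp (t' := Ici 0) s
      (((hasDerivAt_id s).const_add t).hasDerivWithinAt (s := Ici s))
      (fun r hr => add_nonneg ht (hs.1.trans hr))
    rw [hval, one_smul] at h3
    exact h3

variable {φ : Fin m → ℝ → (Fin n → ℂ) → (Fin n → ℂ)} {ρ : ℝ}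

/-- The maximum norm does not increase along the trajectories of a switched system all of whose
flows preserve a polydisk. -/
theorem IsSwitchedTrajectory.norm_le (hF : ∀ i, DifferentiableOn ℂ (F i) (polydisk n 1))
    (hφ : ∀ i, IsForwardFlow (polydisk n 1) (F i) (φ i)) (hF0 : ∀ i, F i 0 = 0)
    (hρ0 : 0 < ρ) (hρ1 : ρ ≤ 1)
    (hinv : ∀ i, ∀ t, 0 ≤ t → MapsTo (φ i t) (polydisk n ρ) (polydisk n ρ))
    (hσ : IsCommutationLaw σ) (hx : IsSwitchedTrajectory (polydisk n 1) F σ x) {a b : ℝ}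
    (ha : 0 ≤ a) (hab : a ≤ b) (hlt : ‖x a‖ < ρ) : ‖x b‖ ≤ ‖x a‖ := by
  -- The threshold is `ρ` because the flows are known to be norm-nonincreasing only inside the
  -- polydisk.
  refine hσ.le_of_eventually_le (u := fun t => ‖x t‖) (c := ρ) ha hab
    (hx.continuousOn.mono fun t ht => ha.trans ht.1).norm (fun t ht hc htρ => ?_) hlt
  have ht0 : 0 ≤ t := ha.trans ht.1.le
  obtain ⟨T, hT, hsol⟩ := hx.exists_isSolution ht0 hc
  have heq := (hφ (σ t)).eqOn (isOpen_polydisk 1) (hF _) hsol (by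
    simpa using hx.mem t ht0)
  filter_upwards [Ioo_mem_nhdsGT (show t < t + T by linarith)] with s hs
  have h1 : x (t + (s - t)) = φ (σ t) (s - t) (x (t + 0)) :=
    heq ⟨by linarith [hs.1], by linarith [hs.2]⟩
  rw [add_sub_cancel, add_zero] at h1
  rw [h1]
  exact IsForwardFlow.norm_le (hF _) (hφ _) (hF0 _) hρ0 hρ1 (hinv _) htρ (by linarith [hs.1])

/-- A common Lyapunov function on a polydisk forces convergence to `0` of those trajectories along
which the norm does not increase. -/
theorem IsSwitchedTrajectory.tendsto_zero {V : (Fin n → ℂ) → ℝ} (hρ0 : 0 < ρ)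
    (hF : ∀ i, ContinuousOn (F i) (polydisk n ρ)) (hV : IsCommonLyapunov F (polydisk n ρ) V)
    (hσ : IsCommutationLaw σ) (hx : IsSwitchedTrajectory X F σ x) (hx0 : ‖x 0‖ < ρ)
    (hmono : ∀ a b, 0 ≤ a → a ≤ b → ‖x b‖ ≤ ‖x a‖) : Tendsto x atTop (𝓝 0) := by
  have hD : IsOpen (polydisk n ρ) := isOpen_polydisk ρ
  rw [Metric.tendsto_atTop]
  by_contra! hcon
  obtain ⟨η, hη, hN⟩ := hcon
  -- By monotonicity, a norm that is at least `η` at arbitrarily late times is so at all times. The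
  -- trajectory then lies in a compact shell on which the derivatives of `V` are bounded away from
  -- `0`.
  have hlow : ∀ t, 0 ≤ t → η ≤ ‖x t‖ := fun t ht => by
    obtain ⟨s, hs, hs'⟩ := hN t
    rw [dist_zero_right] at hs'
    exact hs'.trans (hmono t s ht hs)
  set K : Set (Fin n → ℂ) := closedBall 0 ‖x 0‖ ∩ {z | η ≤ ‖z‖} with hK
  have hKc : IsCompact K :=
    (isCompact_closedBall _ _).inter_right (isClosed_le continuous_const continuous_norm)
  have hxK : ∀ t, 0 ≤ t → x t ∈ K := fun t ht =>
    ⟨mem_closedBall_zero_iff.2 (hmono 0 t le_rfl ht), hlow t ht⟩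
  have hKD : K ⊆ polydisk n ρ := fun z hz => by
    rw [polydisk_eq_ball hρ0]
    exact mem_ball_zero_iff.2 ((mem_closedBall_zero_iff.1 hz.1).trans_lt hx0)
  have hbound : ∀ i, ∃ κ > 0, ∀ z ∈ K, fderiv ℝ V z (F i z) ≤ -κ := fun i => by
    have hc : ContinuousOn (fun z => fderiv ℝ V z (F i z)) K :=
      ((hV.contDiffOn.continuousOn_fderiv_of_isOpen hD le_rfl).clm_apply (hF i)).mono hKD
    obtain ⟨z₀, hz₀, hmax⟩ := hKc.exists_isMaxOn ⟨_, hxK 0 le_rfl⟩ hc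
    refine ⟨-fderiv ℝ V z₀ (F i z₀), neg_pos.2 (hV.deriv_neg i z₀ (hKD hz₀) ?_), fun z hz => ?_⟩
    · rintro rfl
      have : η ≤ ‖(0 : Fin n → ℂ)‖ := hz₀.2
      rw [norm_zero] at this
      exact hη.not_ge this
    · rw [neg_neg]
      exact hmax hz
  choose κ hκ hκle using hbound
  have : Nonempty (Fin m) := ⟨σ 0⟩
  obtain ⟨i₀, hi₀⟩ := Finite.exists_min κ
  have hVd : ∀ z ∈ K, HasFDerivAt V (fderiv ℝ V z) z := fun z hz =>
    ((hV.contDiffOn.differentiableOn one_ne_zero).differentiableAt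
      (hD.mem_nhds (hKD hz))).hasFDerivAt
  -- Half of the guaranteed rate leaves the derivative of `V (x t) + κ i₀ / 2 * t` strictly
  -- negative. The threshold `V (x 0) + 1` only has to exceed the initial value.
  have hdecr : ∀ T, 0 ≤ T → V (x T) + κ i₀ / 2 * T ≤ V (x 0) := fun T hT => by
    have h1 := hσ.le_of_eventually_le (u := fun t => V (x t) + κ i₀ / 2 * t)
      (c := V (x 0) + 1) le_rfl hT (ContinuousOn.add (fun t ht =>
        (hVd _ (hxK t ht.1)).continuousAt.comp_continuousWithinAt
          ((hx.continuousOn t ht.1).mono Icc_subset_Ici_self)) (by fun_prop))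
      (fun t ht hc _ => by
        have hd := (hVd _ (hxK t ht.1.le)).comp_hasDerivWithinAt t
          ((hx.deriv t ht.1.le hc).mono (Ici_subset_Ici.2 ht.1.le))
        refine eventually_le_of_hasDerivWithinAt_neg
          (hd.add ((hasDerivAt_id t).const_mul (κ i₀ / 2)).hasDerivWithinAt) ?_
        have h2 := hκle (σ t) _ (hxK t ht.1.le)
        have h3 := hi₀ (σ t)
        have h4 := hκ i₀
        linarith) (by simp)
    simpa using h1
  have hVnn : 0 ≤ V (x 0) := (hV.pos _ (hKD (hxK 0 le_rfl)) (norm_pos_iff.1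
    (hη.trans_le (hlow 0 le_rfl)))).le
  -- By this time the decrease would have brought `V` down to at most `-1`.
  have hT : 0 ≤ 2 * (V (x 0) + 1) / κ i₀ := by have := hκ i₀; positivity
  have h1 := hdecr _ hT
  have h2 : 0 < V (x (2 * (V (x 0) + 1) / κ i₀)) := hV.pos _ (hKD (hxK _ hT)) (norm_pos_iff.1
    (hη.trans_le (hlow _ hT)))
  have h3 : κ i₀ / 2 * (2 * (V (x 0) + 1) / κ i₀) = V (x 0) + 1 := by
    have := (hκ i₀).ne'
    field_simp
  linarith

/-- A switched system of holomorphic vector fields whose flows preserve a polydisk, with a common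
Lyapunov function there, is globally uniformly asymptotically stable on the polydisk. -/
theorem isGUAS_of_isCommonLyapunov {V : (Fin n → ℂ) → ℝ}
    (hF : ∀ i, DifferentiableOn ℂ (F i) (polydisk n 1))
    (hφ : ∀ i, IsForwardFlow (polydisk n 1) (F i) (φ i)) (hF0 : ∀ i, F i 0 = 0)
    (hρ0 : 0 < ρ) (hρ1 : ρ ≤ 1)
    (hinv : ∀ i, ∀ t, 0 ≤ t → MapsTo (φ i t) (polydisk n ρ) (polydisk n ρ))
    (hV : IsCommonLyapunov F (polydisk n ρ) V) : IsGUAS (polydisk n 1) F (polydisk n ρ) := by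
  have hsub : polydisk n ρ ⊆ polydisk n 1 := fun z hz l => (hz l).trans_le hρ1
  have hnorm : ∀ {σ x}, IsCommutationLaw σ → IsSwitchedTrajectory (polydisk n 1) F σ x →
      ‖x 0‖ < ρ → ∀ t, 0 ≤ t → ‖x t‖ ≤ ‖x 0‖ := fun hσ hx h0 t ht =>
    hx.norm_le hF hφ hF0 hρ0 hρ1 hinv hσ le_rfl ht h0
  have hlim : ∀ σ, IsCommutationLaw σ → ∀ x, IsSwitchedTrajectory (polydisk n 1) F σ x →
      ‖x 0‖ < ρ → Tendsto x atTop (𝓝 0) := fun σ hσ x hx h0 =>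
    hx.tendsto_zero hρ0 (fun i => (hF i).continuousOn.mono hsub) hV hσ h0 fun a b ha hab =>
      hx.norm_le hF hφ hF0 hρ0 hρ1 hinv hσ ha hab ((hnorm hσ hx h0 a ha).trans_lt h0)
  -- Radius `ρ / 2` puts the initial point strictly inside the polydisk, where the norm never grows;
  -- hence `δ ≤ η` suffices.
  refine ⟨⟨fun η hη => ⟨min η (ρ / 2), by positivity, fun σ hσ x hx h0 t ht => ?_⟩,
    ρ / 2, by positivity, fun σ hσ x hx h0 => hlim σ hσ x hx (h0.trans_lt (by linarith))⟩,
    fun σ hσ x hx h0 => hlim σ hσ x hx (by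
      rwa [polydisk_eq_ball hρ0, mem_ball_zero_iff] at h0)⟩
  have h1 : ‖x 0‖ < ρ := (h0.trans (min_le_right _ _)).trans_lt (by linarith)
  exact (hnorm hσ hx h1 t ht.le).trans (h0.trans (min_le_left _ _))

end SwitchedTrajectory

end SwitchedKoopman

/-! ### The main theorem. -/

theorem mainTheorem1 {n m : ℕ} [NeZero n]
    (F : Fin m → (Fin n → ℂ) → (Fin n → ℂ)) (φ : Fin m → ℝ → (Fin n → ℂ) → (Fin n → ℂ))
    (hF : ∀ i, DifferentiableOn ℂ (F i) (polydisk n 1))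
    (hφ : ∀ i, IsForwardFlow (polydisk n 1) (F i) (φ i))
    (heq : ∀ i, F i 0 = 0)
    (hhyp : ∀ i, ∀ μ ∈ spectrum ℂ (jacobian (F i) 0), μ.re < 0)
    (hgas : ∀ i, IsGASFlow (polydisk n 1) (φ i))
    (hsolv : GeneratesSolvable (fun i => jacobian (F i) 0))
    (ρ : ℝ) (hρ0 : 0 < ρ) (hρ1 : ρ ≤ 1)
    (hinv : ∀ i, ∀ t, 0 ≤ t → Set.MapsTo (φ i t) (polydisk n ρ) (polydisk n ρ)) :
    (∃ P : Matrix (Fin n) (Fin n) ℂ,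
      IsNormalizedTriangularizer (fun i => jacobian (F i) 0) P) ∧
    ∀ P : Matrix (Fin n) (Fin n) ℂ,
      IsNormalizedTriangularizer (fun i => jacobian (F i) 0) P →
    ∀ b : Fin m → ℕ → ℕ → ℝ,
      (∀ i j k, 1 ≤ j → 1 ≤ k → 0 ≤ b i j k) →
      (∀ i j k, 1 ≤ j → 1 ≤ k → koopmanEntry (conjField P (F i)) k j ≠ 0 →
        0 < b i j k * b i k j) →
      (∀ i j, 1 ≤ j →
        Summable (fun k : ℕ => b i j (k + 1)) ∧ ∑' k : ℕ, b i j (k + 1) ≤ 1) →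
    ∀ ε : ℕ → ℝ,
      (∀ j, 1 ≤ j → 0 < ε j) →
      (∀ i j k, 1 ≤ k → k < j → ε k * crossRatio (conjField P (F i)) (b i) j k < ε j) →
      Summable (fun k : ℕ => (degree (monomialEnum n (k + 1)) : ℝ) * ε (k + 1)
        * ρ ^ (2 * degree (monomialEnum n (k + 1)))) →
      IsGUAS (polydisk n 1) F (polydisk n ρ) ∧
      (∀ z ∈ polydisk n ρ, Summable (fun k : ℕ =>
        ε (k + 1) * ‖monomial (monomialEnum n (k + 1)) (P⁻¹ *ᵥ z)‖ ^ 2)) ∧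
      IsCommonLyapunov F (polydisk n ρ) (fun z => ∑' k : ℕ,
        ε (k + 1) * ‖monomial (monomialEnum n (k + 1)) (P⁻¹ *ᵥ z)‖ ^ 2) := by
  refine ⟨exists_isNormalizedTriangularizer hsolv, fun P hP b hb0 hb hbs ε hε hεQ hs => ?_⟩
  obtain ⟨hPu, hPn, hT⟩ := hP
  -- The normalization makes `P⁻¹` map the polydisk of radius `ρ` into itself, so each monomial is
  -- bounded by `ρ ^ |α|` at `P⁻¹ z`.
  have hB := norm_mulVec_le hPn
  have hball := polydisk_eq_ball (n := n) hρ0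
  have hdet : IsUnit P.det := (Matrix.isUnit_iff_isUnit_det P).1 hPu
  have hsum : ∀ z ∈ polydisk n ρ, Summable fun k => lyapunovTerm P⁻¹ ε k z := fun z hz =>
    summable_lyapunovTerm hε hB hs (hball ▸ hz)
  have hV : IsCommonLyapunov F (polydisk n ρ) (fun z => ∑' k, lyapunovTerm P⁻¹ ε k z) :=
    { contDiffOn := by
        rw [hball]
        exact contDiffOn_tsum_lyapunovTerm hρ0 hε hB hs
      zero := by
        have h0 : ∀ k, lyapunovTerm P⁻¹ ε k (0 : Fin n → ℂ) = 0 := fun k => by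
          rw [lyapunovTerm, Matrix.mulVec_zero, monomial_zero_apply
            (degree_monomialEnum_ne_zero (by omega)), norm_zero]
          ring
        simp only [h0, tsum_zero]
      pos := fun z hz hz0 => by
        have hw : P⁻¹ *ᵥ z ≠ 0 := fun h => hz0 (by
          rw [← Matrix.one_mulVec z, ← Matrix.mul_nonsing_inv P hdet, ← Matrix.mulVec_mulVec, h,
            Matrix.mulVec_zero])
        obtain ⟨k, hk⟩ := exists_monomial_ne_zero hw
        refine (hsum z hz).tsum_pos (fun k => lyapunovTerm_nonneg hε k z) k ?_
        exact mul_pos (hε _ (by omega)) (pow_pos (norm_pos_iff.2 hk) 2)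
      deriv_neg := fun i z hz hz0 =>
        fderiv_tsum_lyapunovTerm_neg hρ0 hρ1 (hF i) (heq i) hPu hPn (hT i)
          (isDominated_koopmanEntry (hF i) (heq i) (hhyp i) hPu (hT i) (hb0 i) (hb i) (hbs i) hε
            (hεQ i)) hε hs (hball ▸ hz) hz0 }
  exact ⟨isGUAS_of_isCommonLyapunov hF hφ heq hρ0 hρ1 hinv hV, hsum, hV⟩
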